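/- Let $N\ge 4$ and let $\mathbb C^{2N}$ have basis $e_1,\dots,e_N,e_{-N},\dots,e_{-1}$ and the symplectic form $\omega$ with $\omega(e_i,e_j)=\omega(e_{-i},e_{-j})=0$ and $\omega(e_i,e_{-j})=\delta_{ij}$ for $1\le i,j\le N$. Let $\mathrm{LG}(N,2N)\subset\mathbb P(\bigwedge^N\mathbb C^{2N})$ be the Lagrangian Grassmannian of $N$-dimensional $\omega$-isotropic subspaces in its Plücker embedding, and let $\sigma_2(\mathrm{LG}(N,2N))$ be its secant variety of lines, that is, the Zariski closure of the union of the lines spanned by two points of $\mathrm{LG}(N,2N)$. Let \[ \Sigma_2=\mathrm{Sp}_{2N}(\mathbb C)\cdot\big[\,e_1\wedge e_2\wedge e_3\wedge\dots\wedge e_N+e_{-1}\wedge e_{-2}\wedge e_3\wedge\dots\wedge e_N\,\big]\subset\mathbb P(\textstyle\bigwedge^N\mathbb C^{2N}) . \] Then $\Sigma_2\subset\sigma_2(\mathrm{LG}(N,2N))$, and, with respect to the Zariski topology, \[ \dim\Sigma_2=\frac{N(N+1)}{2}+2N-3 . \] -/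

import Mathlib

open scoped LinearAlgebra.Projectivization

noncomputable section

/-- The locus in `ℙ(V)` of the common zeros of a set `S` of polynomials in the linear
functionals on `V`. It is used for homogeneous polynomials only, for which vanishing at one
non-zero vector of a line is the same as vanishing on the whole line. -/
def projZeroLocus (V : Type*) [AddCommGroup V] [Module ℂ V]
    (S : Set (MvPolynomial (Module.Dual ℂ V) ℂ)) : Set (ℙ ℂ V) :=
  {x | ∀ p ∈ S, ∀ v ∈ x.submodule, MvPolynomial.eval (fun φ => φ v) p = 0}

/-- A subset of `ℙ(V)` is Zariski closed if it is cut out by homogeneous polynomials. -/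
def IsZariskiClosed (V : Type*) [AddCommGroup V] [Module ℂ V] (Z : Set (ℙ ℂ V)) : Prop :=
  ∃ S : Set (MvPolynomial (Module.Dual ℂ V) ℂ),
    (∀ p ∈ S, ∃ d : ℕ, p.IsHomogeneous d) ∧ Z = projZeroLocus V S

theorem eval_homogeneous_eq_zero_of_line {V : Type*} [AddCommGroup V] [Module ℂ V]
    {p : MvPolynomial (Module.Dual ℂ V) ℂ} {d : ℕ} (hp : p.IsHomogeneous d) {x : ℙ ℂ V} {v : V}
    (hv : v ∈ x.submodule) (hv0 : v ≠ 0) (h : MvPolynomial.eval (fun φ => φ v) p = 0)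
    {w : V} (hw : w ∈ x.submodule) : MvPolynomial.eval (fun φ => φ w) p = 0 := by
  rw [Projectivization.submodule_eq] at hv hw
  obtain ⟨a, rfl⟩ := Submodule.mem_span_singleton.1 hv
  obtain ⟨b, rfl⟩ := Submodule.mem_span_singleton.1 hw
  have ha : a ≠ 0 := by
    rintro rfl
    simp at hv0
  have key : (fun φ : Module.Dual ℂ V => φ (b • x.rep)) =
      (b * a⁻¹) • (fun φ : Module.Dual ℂ V => φ (a • x.rep)) := by
    funext φ
    simp [mul_assoc, ha]
  have hsmul : ∀ (c : ℂ) (f : Module.Dual ℂ V → ℂ),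
      MvPolynomial.eval (c • f) p = c ^ d * MvPolynomial.eval f p := by
    intro c f
    rw [MvPolynomial.eval_eq, MvPolynomial.eval_eq, Finset.mul_sum]
    refine Finset.sum_congr rfl fun m hm => ?_
    have hd : ∑ i ∈ m.support, m i = d := by
      have := hp (MvPolynomial.mem_support_iff.1 hm)
      simpa [Finsupp.weight_apply, Finsupp.sum] using this
    simp only [Pi.smul_apply, smul_eq_mul, mul_pow, Finset.prod_mul_distrib,
      Finset.prod_pow_eq_pow_sum, hd]
    ring
  rw [key, hsmul, h, mul_zero]

/-- The Zariski topology on the projective space `ℙ(V)`. -/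
@[reducible] def zariskiTopology (V : Type*) [AddCommGroup V] [Module ℂ V] : TopologicalSpace (ℙ ℂ V) :=
  TopologicalSpace.ofClosed {Z | IsZariskiClosed V Z}
    (by
      refine ⟨{1}, ?_, ?_⟩
      · rintro p rfl
        exact ⟨0, MvPolynomial.isHomogeneous_one _ _⟩
      · ext x
        simp only [projZeroLocus, Set.mem_empty_iff_false, Set.mem_ofPred_eq, false_iff]
        intro h
        simpa using h 1 rfl 0 (Submodule.zero_mem _))
    (by
      intro A hA
      refine ⟨{p | (∃ d : ℕ, p.IsHomogeneous d) ∧ ∃ Z ∈ A, ∀ x ∈ Z, ∀ v ∈ x.submodule,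
        MvPolynomial.eval (fun φ => φ v) p = 0}, fun p hp => hp.1, ?_⟩
      ext x
      constructor
      · rintro hx p ⟨-, Z, hZ, h⟩ v hv
        exact h x (hx Z hZ) v hv
      · intro hx Z hZ
        obtain ⟨S, hS, hZS⟩ := hA hZ
        rw [hZS]
        intro p hp v hv
        refine hx p ⟨hS p hp, Z, hZ, ?_⟩ v hv
        intro y hy
        rw [hZS] at hy
        exact hy p hp)
    (by
      rintro Z ⟨S, hS, rfl⟩ Z' ⟨S', hS', rfl⟩
      refine ⟨{r | ∃ p ∈ S, ∃ q ∈ S', r = p * q}, ?_, ?_⟩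
      · rintro r ⟨p, hp, q, hq, rfl⟩
        obtain ⟨d, hd⟩ := hS p hp
        obtain ⟨e, he⟩ := hS' q hq
        exact ⟨d + e, hd.mul he⟩
      · ext x
        constructor
        · rintro (hx | hx) r ⟨p, hp, q, hq, rfl⟩ v hv
          · simp [hx p hp v hv]
          · simp [hx q hq v hv]
        · intro hx
          by_contra hcon
          simp only [Set.mem_union, not_or] at hcon
          obtain ⟨h1, h2⟩ := hcon
          simp only [projZeroLocus, Set.mem_ofPred_eq, not_forall] at h1 h2
          obtain ⟨p, hp, v, hv, hpv⟩ := h1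
          obtain ⟨q, hq, w, hw, hqw⟩ := h2
          obtain ⟨d, hd⟩ := hS p hp
          obtain ⟨e, he⟩ := hS' q hq
          have hr : x.rep ∈ x.submodule := by
            rw [Projectivization.submodule_eq]
            exact Submodule.mem_span_singleton_self _
          have h := hx _ ⟨p, hp, q, hq, rfl⟩ x.rep hr
          rw [map_mul, mul_eq_zero] at h
          rcases h with h | h
          · exact hpv (eval_homogeneous_eq_zero_of_line hd hr x.rep_nonzero h hv)
          · exact hqw (eval_homogeneous_eq_zero_of_line he hr x.rep_nonzero h hw))

/-- The Zariski closure of a subset of `ℙ(V)`. -/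
def zariskiClosure {V : Type*} [AddCommGroup V] [Module ℂ V] (Z : Set (ℙ ℂ V)) : Set (ℙ ℂ V) :=
  @closure (ℙ ℂ V) (zariskiTopology V) Z

/-- The dimension of a subset `Z` of `ℙ(V)`: the Krull dimension of the topological space `Z`,
with the topology induced by the Zariski topology of `ℙ(V)`. -/
def zariskiDim {V : Type*} [AddCommGroup V] [Module ℂ V] (Z : Set (ℙ ℂ V)) : WithBot ℕ∞ :=
  @topologicalKrullDim Z (TopologicalSpace.induced Subtype.val (zariskiTopology V))

/-- The points of `ℙ(V)` lying on the span of two (possibly equal) points of `X`. -/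
def bisecantPoints {V : Type*} [AddCommGroup V] [Module ℂ V] (X : Set (ℙ ℂ V)) : Set (ℙ ℂ V) :=
  {z | ∃ x ∈ X, ∃ y ∈ X, z.submodule ≤ x.submodule ⊔ y.submodule}

/-- The secant variety of lines `σ₂(X)`. -/
def secantVariety {V : Type*} [AddCommGroup V] [Module ℂ V] (X : Set (ℙ ℂ V)) : Set (ℙ ℂ V) :=
  zariskiClosure (bisecantPoints X)

/-- The space `ℂ^{2N}`. The basis vector indexed by `Sum.inl i` is `e_{i+1}`, the one indexed by
`Sum.inr i` is `e_{-(i+1)}`. -/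
abbrev SympSpace (N : ℕ) : Type := Fin N ⊕ Fin N → ℂ

/-- The standard symplectic form: `ω(e_i, e_j) = ω(e_{-i}, e_{-j}) = 0`, `ω(e_i, e_{-j}) = δ_ij`. -/
def sympForm (N : ℕ) (v w : SympSpace N) : ℂ :=
  ∑ i : Fin N, (v (Sum.inl i) * w (Sum.inr i) - v (Sum.inr i) * w (Sum.inl i))

/-- The Lagrangian Grassmannian `LG(N, 2N)` in its Plücker embedding in `ℙ(⋀^N ℂ^{2N})`: the
points `[b₁ ∧ ⋯ ∧ b_N]`, where `b₁, …, b_N` is a basis of an isotropic subspace. -/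
def lagrangianGrassmannian (N : ℕ) : Set (ℙ ℂ (⋀[ℂ]^N (SympSpace N))) :=
  {x | ∃ b : Fin N → SympSpace N, LinearIndependent ℂ b ∧ (∀ i j, sympForm N (b i) (b j) = 0) ∧
    x.submodule = Submodule.span ℂ {exteriorPower.ιMulti ℂ N b}}

/-- The vector `e_1 ∧ ⋯ ∧ e_N + e_{-1} ∧ ⋯ ∧ e_{-s} ∧ e_{s+1} ∧ ⋯ ∧ e_N`, the sum of the
highest weight vector `v` and of `w_s · v`, where the Weyl group element `w_s` exchanges `e_i`
and `e_{-i}` (up to sign) for `1 ≤ i ≤ s`. -/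
def secantVector (N s : ℕ) : ⋀[ℂ]^N (SympSpace N) :=
  exteriorPower.ιMulti ℂ N (fun i : Fin N => (Pi.single (Sum.inl i) 1 : SympSpace N)) +
  exteriorPower.ιMulti ℂ N (fun i : Fin N =>
    (Pi.single (if (i : ℕ) < s then Sum.inr i else Sum.inl i) 1 : SympSpace N))

/-- The orbit `Σ_s` of the point `[secantVector N s]` under the symplectic group `Sp_{2N}(ℂ)`,
which acts on `⋀^N ℂ^{2N}` through its standard action on `ℂ^{2N}`. -/
def secantOrbit (N s : ℕ) : Set (ℙ ℂ (⋀[ℂ]^N (SympSpace N))) :=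
  {x | ∃ g ∈ Matrix.symplecticGroup (Fin N) ℂ,
    x.submodule = Submodule.span ℂ {exteriorPower.map N (Matrix.mulVecLin g) (secantVector N s)}}

end

/-! A translate of the base vector is a sum of the Plücker vectors of two Lagrangian subspaces, so
its point already lies on a secant line and the inclusion needs no closure.

For the dimension, the two subspaces meet in an isotropic subspace `I` of dimension `N - 2`. The
same point is a sum for many pairs through `I`, so parametrizing pairs would overcount. A normal
form removes the ambiguity: generically the pair can be changed, keeping `I`, until the second
subspace is spanned by `I` and two vectors of `⟨e_{-1}, …, e_{-N}⟩`. This is an identity for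
alternating forms in two arguments, `LinearMap.add_alternating_expansion`, carried to the orbit by
`exists_graph_form`. The first subspace is then the graph of a symmetric matrix `S`, giving
`N(N+1)/2` parameters; `I` is the part of the graph above an `(N-2)`-space given by a `2 × (N-2)`
matrix `x`; a scalar `q` weighs the two summands. The total is `N(N+1)/2 + 2(N-2) + 1`.

The parameters are rational functions of the point. The second summand is invisible to the Plücker
coordinates of order zero and one, which therefore give `S`. Certain quadrics vanish on graphs and
see only the cross term of the two summands; their values are `q` times the `2 × 2` minors of a
matrix built from `x`, hence give `q` and `x`.

Such a chart with rational inverse determines the Krull dimension. Chains of irreducible closed sets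
through a chart become chains of primes in a polynomial ring (`ProjChart.zariskiDim_le`), while
coordinate slices form a chain of full length (`ProjChart.le_zariskiDim`). Translating one chart by
the group covers the orbit. -/

open scoped LinearAlgebra.Projectivization

/-! ### Krull dimension of subsets of projective space from rational charts -/

section ProjectiveCharts

attribute [local instance] zariskiTopology

variable {V : Type*} [AddCommGroup V] [Module ℂ V]

/-- The value at `v` of a polynomial in the linear functionals on `V`. -/
noncomputable def evalAt (p : MvPolynomial (Module.Dual ℂ V) ℂ) (v : V) : ℂ :=
  MvPolynomial.eval (fun φ => φ v) p

theorem evalAt_smul {p : MvPolynomial (Module.Dual ℂ V) ℂ} {d : ℕ} (hp : p.IsHomogeneous d)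
    (c : ℂ) (v : V) : evalAt p (c • v) = c ^ d * evalAt p v := by
  have key : (fun φ : Module.Dual ℂ V => φ (c • v)) = fun φ => c * φ v := by
    funext φ
    simp
  rw [evalAt, evalAt, key, MvPolynomial.eval_eq, MvPolynomial.eval_eq, Finset.mul_sum]
  refine Finset.sum_congr rfl fun m hm => ?_
  have hd : ∑ i ∈ m.support, m i = d := by
    have := hp (MvPolynomial.mem_support_iff.1 hm)
    simpa [Finsupp.weight_apply, Finsupp.sum] using this
  simp only [mul_pow, Finset.prod_mul_distrib, Finset.prod_pow_eq_pow_sum, hd]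
  ring

@[simp] theorem evalAt_mul (p q : MvPolynomial (Module.Dual ℂ V) ℂ) (v : V) :
    evalAt (p * q) v = evalAt p v * evalAt q v := map_mul _ _ _

@[simp] theorem evalAt_add (p q : MvPolynomial (Module.Dual ℂ V) ℂ) (v : V) :
    evalAt (p + q) v = evalAt p v + evalAt q v := map_add _ _ _

@[simp] theorem evalAt_sub (p q : MvPolynomial (Module.Dual ℂ V) ℂ) (v : V) :
    evalAt (p - q) v = evalAt p v - evalAt q v := map_sub _ _ _

@[simp] theorem evalAt_neg (p : MvPolynomial (Module.Dual ℂ V) ℂ) (v : V) :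
    evalAt (-p) v = -evalAt p v := map_neg _ _

@[simp] theorem evalAt_pow (p : MvPolynomial (Module.Dual ℂ V) ℂ) (k : ℕ) (v : V) :
    evalAt (p ^ k) v = evalAt p v ^ k := map_pow _ _ _

@[simp] theorem evalAt_X (ℓ : Module.Dual ℂ V) (v : V) :
    evalAt (MvPolynomial.X ℓ) v = ℓ v := MvPolynomial.eval_X _

@[simp] theorem evalAt_C (c : ℂ) (v : V) :
    evalAt (MvPolynomial.C c) v = c := MvPolynomial.eval_C _

theorem rep_mem_submodule (x : ℙ ℂ V) : x.rep ∈ x.submodule := by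
  rw [Projectivization.submodule_eq]
  exact Submodule.mem_span_singleton_self _

theorem isClosed_iff_isZariskiClosed {Z : Set (ℙ ℂ V)} : IsClosed Z ↔ IsZariskiClosed V Z := by
  rw [← isOpen_compl_iff]
  change Zᶜᶜ ∈ {Z | IsZariskiClosed V Z} ↔ _
  rw [compl_compl]
  rfl

theorem isClosed_evalAt_eq_zero {p : MvPolynomial (Module.Dual ℂ V) ℂ} {d : ℕ}
    (hp : p.IsHomogeneous d) : IsClosed {x : ℙ ℂ V | evalAt p x.rep = 0} := by
  rw [isClosed_iff_isZariskiClosed]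
  refine ⟨{p}, fun q hq => ⟨d, by rwa [Set.mem_singleton_iff.1 hq]⟩, ?_⟩
  ext x
  constructor
  · rintro hx q rfl v hv
    exact eval_homogeneous_eq_zero_of_line hp (rep_mem_submodule x) x.rep_nonzero hx hv
  · intro hx
    exact hx p rfl _ (rep_mem_submodule x)

theorem isOpen_evalAt_ne_zero {p : MvPolynomial (Module.Dual ℂ V) ℂ} {d : ℕ}
    (hp : p.IsHomogeneous d) : IsOpen {x : ℙ ℂ V | evalAt p x.rep ≠ 0} :=
  (isClosed_evalAt_eq_zero hp).isOpen_compl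

theorem exists_evalAt_separating {Z : Set (ℙ ℂ V)} (hZ : IsClosed Z) {x : ℙ ℂ V} (hx : x ∉ Z) :
    ∃ (p : MvPolynomial (Module.Dual ℂ V) ℂ) (d : ℕ), p.IsHomogeneous d ∧
      (∀ z ∈ Z, evalAt p z.rep = 0) ∧ evalAt p x.rep ≠ 0 := by
  rw [isClosed_iff_isZariskiClosed] at hZ
  obtain ⟨S, hS, rfl⟩ := hZ
  simp only [projZeroLocus, Set.mem_ofPred_eq, not_forall] at hx
  obtain ⟨p, hp, v, hv, hpv⟩ := hx
  obtain ⟨d, hd⟩ := hS p hp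
  refine ⟨p, d, hd, fun z hz => hz p hp _ (rep_mem_submodule z), fun h => hpv ?_⟩
  exact eval_homogeneous_eq_zero_of_line hd (rep_mem_submodule x) x.rep_nonzero h hv

/-- A rational chart of a subset `X` of `ℙ(V)`: a polynomial map `toFun` from an affine space to
`V` whose inverse is given, where `den` does not vanish, by the quotients `num i / den` of
homogeneous polynomials of the same degree. -/
structure ProjChart (X : Set (ℙ ℂ V)) (ι : Type*) where
  /-- the parametrization -/
  toFun : (ι → ℂ) → V
  poly : ∀ ℓ : Module.Dual ℂ V, ∃ P : MvPolynomial ι ℂ, ∀ a, ℓ (toFun a) = MvPolynomial.eval a P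
  /-- the common degree of the numerators and the denominator -/
  deg : ℕ
  /-- the denominator -/
  den : MvPolynomial (Module.Dual ℂ V) ℂ
  /-- the numerators -/
  num : ι → MvPolynomial (Module.Dual ℂ V) ℂ
  den_hom : den.IsHomogeneous deg
  num_hom : ∀ i, (num i).IsHomogeneous deg
  eval_num : ∀ a i, evalAt (num i) (toFun a) = a i * evalAt den (toFun a)
  ne_zero : ∀ a, toFun a ≠ 0
  mem : ∀ a, evalAt den (toFun a) ≠ 0 → Projectivization.mk ℂ (toFun a) (ne_zero a) ∈ X
  surj : ∀ x ∈ X, evalAt den x.rep ≠ 0 → ∃ a, ∃ c : ℂ, x.rep = c • toFun a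

namespace ProjChart

variable {X : Set (ℙ ℂ V)} {ι : Type*} (c : ProjChart X ι)

theorem exists_pullback (p : MvPolynomial (Module.Dual ℂ V) ℂ) :
    ∃ P : MvPolynomial ι ℂ, ∀ a, evalAt p (c.toFun a) = MvPolynomial.eval a P := by
  choose Q hQ using c.poly
  refine ⟨MvPolynomial.bind₁ Q p, fun a => ?_⟩
  rw [MvPolynomial.eval, MvPolynomial.eval₂Hom_bind₁, evalAt, MvPolynomial.eval]
  simp only [hQ]
  rfl

/-- The coordinates of a point in a chart. -/
noncomputable def coords (x : ℙ ℂ V) (i : ι) : ℂ := evalAt (c.num i) x.rep / evalAt c.den x.rep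

theorem rep_eq {x : ℙ ℂ V} (hx : x ∈ X) (h : evalAt c.den x.rep ≠ 0) :
    ∃ t : ℂ, t ≠ 0 ∧ x.rep = t • c.toFun (c.coords x) := by
  obtain ⟨a, t, hat⟩ := c.surj x hx h
  have ht : t ≠ 0 := by
    rintro rfl
    exact x.rep_nonzero (by simpa using hat)
  refine ⟨t, ht, ?_⟩
  suffices c.coords x = a by rw [this, hat]
  funext i
  rw [coords, div_eq_iff h, hat, evalAt_smul (c.num_hom i), evalAt_smul c.den_hom, c.eval_num]
  ring

/-- Clearing denominators in `P(num / den)`. All large exponents `k` are allowed, so that two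
summands can be brought to the same degree. -/
theorem exists_homogenization (P : MvPolynomial ι ℂ) :
    ∃ m : ℕ, ∀ k, m ≤ k → ∃ H : MvPolynomial (Module.Dual ℂ V) ℂ, H.IsHomogeneous (k * c.deg) ∧
      ∀ x : ℙ ℂ V, evalAt c.den x.rep ≠ 0 →
        evalAt H x.rep = evalAt c.den x.rep ^ k * MvPolynomial.eval (c.coords x) P := by
  induction P using MvPolynomial.induction_on with
  | C a =>
    refine ⟨0, fun k _ => ⟨MvPolynomial.C a * c.den ^ k, ?_, fun x _ => by simp [mul_comm]⟩⟩
    have := (MvPolynomial.isHomogeneous_C (Module.Dual ℂ V) a).mul (c.den_hom.pow k)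
    rwa [zero_add, mul_comm c.deg] at this
  | add p q hp hq =>
    obtain ⟨m, hm⟩ := hp
    obtain ⟨m', hm'⟩ := hq
    refine ⟨max m m', fun k hk => ?_⟩
    obtain ⟨H, hH, hHe⟩ := hm k (le_trans (le_max_left _ _) hk)
    obtain ⟨H', hH', hHe'⟩ := hm' k (le_trans (le_max_right _ _) hk)
    refine ⟨H + H', hH.add hH', fun x hx => ?_⟩
    rw [evalAt_add, hHe x hx, hHe' x hx, map_add]
    ring
  | mul_X p i hp =>
    obtain ⟨m, hm⟩ := hp
    refine ⟨m + 1, fun k hk => ?_⟩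
    obtain ⟨k, rfl⟩ : ∃ l, k = l + 1 := ⟨k - 1, by omega⟩
    obtain ⟨H, hH, hHe⟩ := hm k (by omega)
    refine ⟨H * c.num i, ?_, fun x hx => ?_⟩
    · rw [add_mul, one_mul]
      exact hH.mul (c.num_hom i)
    · rw [evalAt_mul, hHe x hx, map_mul, MvPolynomial.eval_X, coords]
      field_simp
      ring

/-- The polynomials in the coordinates of the chart that vanish on `Z`. -/
def vanishingIdeal (Z : Set X) : Ideal (MvPolynomial ι ℂ) where
  carrier := {P | ∀ z ∈ Z, evalAt c.den (z : ℙ ℂ V).rep ≠ 0 →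
    MvPolynomial.eval (c.coords z) P = 0}
  add_mem' := by
    intro P Q hP hQ z hz h
    rw [map_add, hP z hz h, hQ z hz h, add_zero]
  zero_mem' := by
    intro z hz h
    exact map_zero _
  smul_mem' := by
    intro P Q hQ z hz h
    rw [smul_eq_mul, map_mul, hQ z hz h, mul_zero]

/-- If `P * Q` vanishes on the chart part of `Z`, then `Z` is covered by two closed sets, the zeros
of `den` times a homogenization of `P`, respectively of `Q`. Irreducibility puts `Z` inside one of
them. -/
theorem vanishingIdeal_isPrime {Z : Set X} (hZ : IsIrreducible Z)
    (hne : ∃ z ∈ Z, evalAt c.den (z : ℙ ℂ V).rep ≠ 0) : (c.vanishingIdeal Z).IsPrime := by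
  refine Ideal.isPrime_iff.2 ⟨?_, ?_⟩
  · rw [Ideal.ne_top_iff_one]
    intro h
    obtain ⟨z, hz, hd⟩ := hne
    simpa using h z hz hd
  · intro P Q hPQ
    have aux : ∀ P : MvPolynomial ι ℂ, ∃ C : Set X, IsClosed C ∧
        ∀ z, z ∈ C ↔ (evalAt c.den (z : ℙ ℂ V).rep ≠ 0 →
          MvPolynomial.eval (c.coords z) P = 0) := by
      intro P
      obtain ⟨m, hm⟩ := c.exists_homogenization P
      obtain ⟨H, hH, hHe⟩ := hm m le_rfl
      refine ⟨Subtype.val ⁻¹' {x : ℙ ℂ V | evalAt (c.den * H) x.rep = 0},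
        (isClosed_evalAt_eq_zero (c.den_hom.mul hH)).preimage continuous_subtype_val,
        fun z => ?_⟩
      by_cases hd : evalAt c.den (z : ℙ ℂ V).rep = 0
      · simp [hd]
      · simp [hd, hHe z hd]
    obtain ⟨C, hC, hCm⟩ := aux P
    obtain ⟨D, hD, hDm⟩ := aux Q
    have hsub : Z ⊆ C ∪ D := by
      intro z hz
      by_cases hd : evalAt c.den (z : ℙ ℂ V).rep = 0
      · exact Or.inl ((hCm z).2 fun h => absurd hd h)
      · have := hPQ z hz hd
        rw [map_mul, mul_eq_zero] at this
        exact this.imp (fun h => (hCm z).2 fun _ => h) (fun h => (hDm z).2 fun _ => h)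
    rcases isPreirreducible_iff_isClosed_union_isClosed.1 hZ.2 C D hC hD hsub with h | h
    · exact Or.inl fun z hz => (hCm z).1 (h hz)
    · exact Or.inr fun z hz => (hDm z).1 (h hz)

theorem vanishingIdeal_lt {Z Z' : TopologicalSpace.IrreducibleCloseds X} (hlt : Z < Z')
    (hne : ∃ z ∈ Z, evalAt c.den (z : ℙ ℂ V).rep ≠ 0) :
    c.vanishingIdeal (Z' : Set X) < c.vanishingIdeal (Z : Set X) := by
  have hsub : (Z : Set X) ⊆ Z' := fun z hz => hlt.le hz
  refine lt_of_le_not_ge (fun P hP z hz => hP z (hsub hz)) fun hge => ?_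
  obtain ⟨x, hxZ', hxZ⟩ : ∃ x, x ∈ (Z' : Set X) ∧ x ∉ (Z : Set X) := by
    by_contra! h
    exact hlt.not_ge fun z hz => h z hz
  obtain ⟨C, hC, hCZ⟩ := isClosed_induced_iff.1 Z.isClosed
  have hxC : (x : ℙ ℂ V) ∉ C := fun h => hxZ (by rw [← hCZ]; exact h)
  obtain ⟨p, d, hp, hpC, hpx⟩ := exists_evalAt_separating hC hxC
  obtain ⟨z₀, hz₀, hd₀⟩ := hne
  -- The separating point `x` may lie outside the chart. Since `Z'` is irreducible, the non-empty
  -- open subsets `p ≠ 0` and `den ≠ 0` of it meet, which moves the witness into the chart.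
  obtain ⟨z, hz, hzp, hzd⟩ := Z'.isIrreducible.2 _ _
    ((isOpen_evalAt_ne_zero hp).preimage continuous_subtype_val)
    ((isOpen_evalAt_ne_zero c.den_hom).preimage continuous_subtype_val)
    ⟨x, hxZ', hpx⟩ ⟨z₀, hsub hz₀, hd₀⟩
  obtain ⟨P, hP⟩ := c.exists_pullback p
  have hPZ : P ∈ c.vanishingIdeal (Z : Set X) := by
    intro w hw hd
    obtain ⟨t, ht, hwt⟩ := c.rep_eq w.2 hd
    have h0 := hpC w (by rw [← hCZ] at hw; exact hw)
    rw [hwt, evalAt_smul hp, hP] at h0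
    exact (mul_eq_zero.1 h0).resolve_left (pow_ne_zero _ ht)
  obtain ⟨t, ht, hzt⟩ := c.rep_eq z.2 hzd
  have h1 := hge hPZ z hz hzd
  rw [← hP] at h1
  apply hzp
  rw [hzt, evalAt_smul hp, h1, mul_zero]

/-- A subset of projective space covered by charts from `ι`-dimensional affine space has
dimension at most the cardinality of `ι`. -/
theorem zariskiDim_le [Fintype ι]
    (h : ∀ x ∈ X, ∃ c : ProjChart X ι, evalAt c.den x.rep ≠ 0) :
    zariskiDim X ≤ (Fintype.card ι : WithBot ℕ∞) := by
  refine iSup_le fun p => ?_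
  -- A point of the smallest member lies in every member, so one chart around it serves the whole
  -- chain. Larger sets have smaller ideals, hence the order dual below.
  obtain ⟨x, hx⟩ := (p 0).isIrreducible.nonempty
  obtain ⟨c, hc⟩ := h x x.2
  have hne : ∀ i, ∃ z ∈ p i, evalAt c.den (z : ℙ ℂ V).rep ≠ 0 :=
    fun i => ⟨x, p.strictMono.monotone (Fin.zero_le i) hx, hc⟩
  let q : LTSeries (PrimeSpectrum (MvPolynomial ι ℂ))ᵒᵈ :=
    { length := p.length
      toFun := fun i => OrderDual.toDual
        ⟨c.vanishingIdeal (p i : Set X), c.vanishingIdeal_isPrime (p i).isIrreducible (hne i)⟩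
      step := fun i => c.vanishingIdeal_lt (p.step i) (hne _) }
  have hq := Order.LTSeries.length_le_krullDim q
  rw [Order.krullDim_orderDual] at hq
  refine hq.trans (le_of_eq ?_)
  change ringKrullDim _ = _
  rw [MvPolynomial.ringKrullDim_of_isNoetherianRing, ringKrullDim_eq_zero_of_field, zero_add,
    Nat.card_eq_fintype_card]

/-- Restricted to the line through `a` and `b`, both become non-zero polynomials in one variable
over an infinite field, so their product has a non-root. Staying on the line keeps the coordinates
on which `a` and `b` agree. -/
theorem exists_line_eval_ne_zero {P Q : MvPolynomial ι ℂ} {a b : ι → ℂ}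
    (hP : MvPolynomial.eval a P ≠ 0) (hQ : MvPolynomial.eval b Q ≠ 0) :
    ∃ t : ℂ, MvPolynomial.eval (fun i => a i + t * (b i - a i)) P ≠ 0 ∧
      MvPolynomial.eval (fun i => a i + t * (b i - a i)) Q ≠ 0 := by
  let L : ι → Polynomial ℂ := fun i => Polynomial.C (a i) + Polynomial.X * Polynomial.C (b i - a i)
  have key : ∀ (R : MvPolynomial ι ℂ) (t : ℂ), (MvPolynomial.aeval L R).eval t =
      MvPolynomial.eval (fun i => a i + t * (b i - a i)) R := by
    intro R t
    rw [← Polynomial.coe_evalRingHom, MvPolynomial.aeval_def, MvPolynomial.hom_eval₂]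
    have h1 : (Polynomial.evalRingHom t).comp (algebraMap ℂ (Polynomial ℂ)) = RingHom.id ℂ := by
      ext z
      · simp
    have h2 : (fun i => (Polynomial.evalRingHom t) (L i)) = fun i => a i + t * (b i - a i) := by
      funext i
      simp [L]
    rw [h1, h2]
    rfl
  have hP' : MvPolynomial.aeval L P ≠ 0 := by
    intro h
    have := key P 0
    rw [h] at this
    simp at this
    exact hP this.symm
  have hQ' : MvPolynomial.aeval L Q ≠ 0 := by
    intro h
    have := key Q 1
    rw [h] at this
    simp at this
    exact hQ this.symm
  by_contra! hcon
  refine mul_ne_zero hP' hQ' (Polynomial.funext fun t => ?_)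
  rw [Polynomial.eval_mul, key, key, Polynomial.eval_zero, mul_eq_zero]
  by_contra! h
  exact h.2 (hcon t h.1)

/-- The point of `ℙ(V)` with the given coordinates. -/
noncomputable def point (a : ι → ℂ) : ℙ ℂ V := Projectivization.mk ℂ (c.toFun a) (c.ne_zero a)

theorem evalAt_point {p : MvPolynomial (Module.Dual ℂ V) ℂ} {d : ℕ} (hp : p.IsHomogeneous d)
    (a : ι → ℂ) : evalAt p (c.point a).rep = 0 ↔ evalAt p (c.toFun a) = 0 := by
  obtain ⟨t, ht⟩ := Projectivization.exists_smul_eq_mk_rep ℂ (c.toFun a) (c.ne_zero a)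
  rw [point, ← ht, Units.smul_def, evalAt_smul hp, mul_eq_zero]
  simp

/-- The points of a chart whose coordinates agree with those of `a₀` on `s`. -/
def slice (a₀ : ι → ℂ) (s : Set ι) : Set X :=
  {x | ∃ a, (∀ i ∈ s, a i = a₀ i) ∧ evalAt c.den (c.toFun a) ≠ 0 ∧ (x : ℙ ℂ V) = c.point a}

theorem slice_isIrreducible {a₀ : ι → ℂ} (h₀ : evalAt c.den (c.toFun a₀) ≠ 0) (s : Set ι) :
    IsIrreducible (c.slice a₀ s) := by
  refine ⟨⟨⟨c.point a₀, c.mem a₀ h₀⟩, a₀, fun _ _ => rfl, h₀, rfl⟩, ?_⟩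
  have aux : ∀ (u : Set X) (x : X) (a : ι → ℂ), IsOpen u → x ∈ u → (x : ℙ ℂ V) = c.point a →
      ∃ P : MvPolynomial ι ℂ, MvPolynomial.eval a P ≠ 0 ∧
        ∀ (y : X) (b : ι → ℂ), (y : ℙ ℂ V) = c.point b → MvPolynomial.eval b P ≠ 0 → y ∈ u := by
    intro u x a hu hx hxa
    obtain ⟨U, hU, rfl⟩ := isOpen_induced_iff.1 hu
    obtain ⟨p, d, hp, hpU, hpx⟩ := exists_evalAt_separating hU.isClosed_compl
      (x := x) (fun h => h hx)
    obtain ⟨P, hP⟩ := c.exists_pullback p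
    refine ⟨P, ?_, ?_⟩
    · rw [← hP, Ne, ← c.evalAt_point hp, ← hxa]
      exact hpx
    · intro y b hyb hb
      by_contra hy
      refine hb ?_
      rw [← hP, ← c.evalAt_point hp, ← hyb]
      exact hpU y hy
  rintro u v hu hv ⟨x, ⟨a, ha, had, hxa⟩, hxu⟩ ⟨y, ⟨b, hb, hbd, hyb⟩, hyv⟩
  obtain ⟨P, hPa, hP⟩ := aux u x a hu hxu hxa
  obtain ⟨Q, hQb, hQ⟩ := aux v y b hv hyv hyb
  obtain ⟨D, hD⟩ := c.exists_pullback c.den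
  -- The factor `D` keeps the new point in the domain of the chart, and the line stays in the slice
  -- because both ends do.
  obtain ⟨t, ht1, ht2⟩ := exists_line_eval_ne_zero (P := P * D) (Q := Q) (a := a) (b := b)
    (by rw [map_mul]; exact mul_ne_zero hPa (by rwa [← hD])) hQb
  rw [map_mul, ← hD] at ht1
  have htd := right_ne_zero_of_mul ht1
  refine ⟨⟨c.point _, c.mem _ htd⟩, ⟨_, ?_, htd, rfl⟩,
    hP _ _ rfl (left_ne_zero_of_mul ht1), hQ _ _ rfl ht2⟩
  intro i hi
  simp [ha i hi, hb i hi]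

theorem closure_slice_ssubset {a₀ : ι → ℂ} (h₀ : evalAt c.den (c.toFun a₀) ≠ 0) {s s' : Set ι}
    (hss : s ⊂ s') : closure (c.slice a₀ s') ⊂ closure (c.slice a₀ s) := by
  classical
  refine ⟨closure_mono ?_, fun hsub => ?_⟩
  · rintro x ⟨a, ha, hx⟩
    exact ⟨a, fun i hi => ha i (hss.1 hi), hx⟩
  obtain ⟨i, his', his⟩ := Set.not_subset.1 hss.2
  obtain ⟨D, hD⟩ := c.exists_pullback c.den
  -- Moving only the freed coordinate `i` gives a point of the larger slice off the hypersurface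
  -- `num i = a₀ i * den`, which contains the closure of the smaller one.
  obtain ⟨t, ht1, ht2⟩ := exists_line_eval_ne_zero (P := D)
    (Q := MvPolynomial.X i - MvPolynomial.C (a₀ i)) (a := a₀)
    (b := Function.update a₀ i (a₀ i + 1)) (by rwa [← hD]) (by simp)
  rw [← hD] at ht1
  have hhom : (c.num i - MvPolynomial.C (a₀ i) * c.den).IsHomogeneous c.deg := by
    refine (c.num_hom i).sub ?_
    have := (MvPolynomial.isHomogeneous_C (Module.Dual ℂ V) (a₀ i)).mul c.den_hom
    rwa [zero_add] at this
  have hval : ∀ a, evalAt (c.num i - MvPolynomial.C (a₀ i) * c.den) (c.toFun a) =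
      (a i - a₀ i) * evalAt c.den (c.toFun a) := by
    intro a
    rw [evalAt_sub, evalAt_mul, evalAt_C, c.eval_num]
    ring
  have hcl : closure (c.slice a₀ s') ⊆ Subtype.val ⁻¹'
      {x : ℙ ℂ V | evalAt (c.num i - MvPolynomial.C (a₀ i) * c.den) x.rep = 0} := by
    refine closure_minimal ?_ ((isClosed_evalAt_eq_zero hhom).preimage continuous_subtype_val)
    rintro x ⟨a, ha, -, hx⟩
    change evalAt _ (x : ℙ ℂ V).rep = 0
    rw [hx, c.evalAt_point hhom, hval, ha i his', sub_self, zero_mul]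
  have hmem := hcl (hsub (subset_closure (a := (⟨c.point _, c.mem _ ht1⟩ : X))
    ⟨_, fun j hj => ?_, ht1, rfl⟩))
  · change evalAt _ (c.point _).rep = 0 at hmem
    rw [c.evalAt_point hhom, hval, mul_eq_zero] at hmem
    refine ht2 ?_
    rw [map_sub, MvPolynomial.eval_X, MvPolynomial.eval_C]
    exact hmem.resolve_right ht1
  · rw [Function.update_of_ne (by rintro rfl; exact his hj)]
    ring

/-- A subset of projective space with a non-empty chart from `ι`-dimensional affine space has
dimension at least the cardinality of `ι`. -/
theorem le_zariskiDim [Fintype ι] {a₀ : ι → ℂ} (h₀ : evalAt c.den (c.toFun a₀) ≠ 0) :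
    (Fintype.card ι : WithBot ℕ∞) ≤ zariskiDim X := by
  let e := Fintype.equivFin ι
  -- The coordinates still frozen at stage `k`: all of them for `k = 0`, none for `k = card ι`.
  let s : ℕ → Set ι := fun k => {i | k ≤ (e i : ℕ)}
  let q : LTSeries (TopologicalSpace.IrreducibleCloseds X) :=
    { length := Fintype.card ι
      toFun := fun k => ⟨closure (c.slice a₀ (s k)), (c.slice_isIrreducible h₀ _).closure,
        isClosed_closure⟩
      step := fun k => by
        have hss : s (k.succ : ℕ) ⊂ s (k.castSucc : ℕ) := by
          refine ⟨fun i hi => ?_, fun h => ?_⟩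
          · simp only [s, Set.mem_ofPred_eq, Fin.val_succ, Fin.val_castSucc] at hi ⊢
            omega
          · have := @h (e.symm k) (by simp [s])
            simp [s] at this
        exact c.closure_slice_ssubset h₀ hss }
  exact Order.LTSeries.length_le_krullDim q

/-- The image of a chart under an invertible linear map preserving `X`. -/
noncomputable def transport (f f' : V →ₗ[ℂ] V) (hff' : ∀ v, f (f' v) = v) (hf'f : ∀ v, f' (f v) = v)
    (hX : ∀ (v : V) (hv : v ≠ 0) (hfv : f v ≠ 0),
      Projectivization.mk ℂ v hv ∈ X → Projectivization.mk ℂ (f v) hfv ∈ X)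
    (hX' : ∀ (v : V) (hv : v ≠ 0) (hfv : f' v ≠ 0),
      Projectivization.mk ℂ v hv ∈ X → Projectivization.mk ℂ (f' v) hfv ∈ X) : ProjChart X ι where
  toFun a := f (c.toFun a)
  poly ℓ := c.poly (ℓ ∘ₗ f)
  deg := c.deg
  den := MvPolynomial.rename (fun ℓ : Module.Dual ℂ V => ℓ ∘ₗ f') c.den
  num i := MvPolynomial.rename (fun ℓ : Module.Dual ℂ V => ℓ ∘ₗ f') (c.num i)
  den_hom := c.den_hom.rename_isHomogeneous
  num_hom i := (c.num_hom i).rename_isHomogeneous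
  eval_num a i := by
    have := c.eval_num a i
    simpa [evalAt, MvPolynomial.eval_rename, Function.comp_def, hf'f] using this
  ne_zero a h := c.ne_zero a (by rw [← hf'f (c.toFun a), h, map_zero])
  mem a h := by
    refine hX _ (c.ne_zero a) _ (c.mem a ?_)
    simpa [evalAt, MvPolynomial.eval_rename, Function.comp_def, hf'f] using h
  surj x hx h := by
    have hne : f' x.rep ≠ 0 := fun h0 => x.rep_nonzero (by rw [← hff' x.rep, h0, map_zero])
    have hmem := hX' x.rep x.rep_nonzero hne (by rwa [Projectivization.mk_rep])
    obtain ⟨t, ht⟩ := Projectivization.exists_smul_eq_mk_rep ℂ _ hne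
    obtain ⟨a, r, har⟩ := c.surj _ hmem (by
      rw [← ht, Units.smul_def, evalAt_smul c.den_hom]
      refine mul_ne_zero (pow_ne_zero _ t.ne_zero) ?_
      simpa [evalAt, MvPolynomial.eval_rename, Function.comp_def] using h)
    refine ⟨a, (t : ℂ)⁻¹ * r, ?_⟩
    rw [mul_smul, ← map_smul f r, ← har, ← ht, Units.smul_def, map_smul, hff',
      inv_smul_smul₀ t.ne_zero]

theorem evalAt_transport_den (f f' : V →ₗ[ℂ] V) (hff' hf'f hX hX') (v : V) :
    evalAt (c.transport f f' hff' hf'f hX hX').den v = evalAt c.den (f' v) := by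
  simp [transport, evalAt, MvPolynomial.eval_rename, Function.comp_def]

end ProjChart

end ProjectiveCharts

/-! ### Plücker coordinates of wedges of block columns -/

section WedgeCoordinates

open Matrix

/-- Both sides are alternating in the columns of `K`, so it suffices to compare them on distinct
standard basis vectors, where `K` is a permutation matrix and both give its sign. -/
theorem AlternatingMap.map_sum_smul_eq_det_smul {ι M M' : Type*} [Fintype ι] [DecidableEq ι]
    [AddCommGroup M] [Module ℂ M] [AddCommGroup M'] [Module ℂ M'] (f : M [⋀^ι]→ₗ[ℂ] M')
    (v : ι → M) (K : Matrix ι ι ℂ) : f (fun j => ∑ i, K i j • v i) = K.det • f v := by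
  have key : f.compLinearMap (Fintype.linearCombination ℂ v) =
      (LinearMap.toSpanSingleton ℂ M' (f v)).compAlternatingMap Matrix.detRowAlternating := by
    refine Module.Basis.ext_alternating (Pi.basisFun ℂ ι) fun σ hσ => ?_
    let τ : Equiv.Perm ι := Equiv.ofBijective σ (Finite.injective_iff_bijective.1 hσ)
    have h1 : (fun i => (Fintype.linearCombination ℂ v) ((Pi.basisFun ℂ ι) (σ i))) = v ∘ τ := by
      funext i
      simp [Fintype.linearCombination_apply, Pi.single_apply, τ]
    have h2 : Matrix.detRowAlternating (fun i => (Pi.basisFun ℂ ι) (σ i)) =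
        ((Equiv.Perm.sign τ : ℤ) : ℂ) := by
      change Matrix.det _ = _
      rw [← Matrix.det_permutation τ]
      congr 1
      ext i j
      simp [Equiv.Perm.permMatrix, PEquiv.toMatrix_apply, Pi.single_apply, τ, eq_comm]
    rw [AlternatingMap.compLinearMap_apply, LinearMap.compAlternatingMap_apply, h2]
    change f (fun i => (Fintype.linearCombination ℂ v) ((Pi.basisFun ℂ ι) (σ i))) = _
    rw [h1, AlternatingMap.map_perm, LinearMap.toSpanSingleton_apply, Units.smul_def,
      Int.cast_smul_eq_zsmul]
  have := congrArg (fun g => g (fun j i => K i j)) key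
  simp only [AlternatingMap.compLinearMap_apply, LinearMap.compAlternatingMap_apply,
    LinearMap.toSpanSingleton_apply, Fintype.linearCombination_apply] at this
  rw [← Matrix.det_transpose]
  exact this

variable {m : ℕ}

/-- The vector of `ℂ^{2N}` whose coordinates are the `j`-th columns of `A` and `C`. -/
def blockCol (A C : Matrix (Fin 2 ⊕ Fin m) (Fin 2 ⊕ Fin m) ℂ) (j : Fin 2 ⊕ Fin m) :
    SympSpace (2 + m) :=
  Sum.elim (fun i => A (finSumFinEquiv.symm i) j) (fun i => C (finSumFinEquiv.symm i) j)

/-- The wedge product of the columns of the block matrix with rows `A` and `C`. -/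
noncomputable def wedge (A C : Matrix (Fin 2 ⊕ Fin m) (Fin 2 ⊕ Fin m) ℂ) :
    ⋀[ℂ]^(2 + m) (SympSpace (2 + m)) :=
  exteriorPower.ιMulti ℂ (2 + m) fun j => blockCol A C (finSumFinEquiv.symm j)

theorem wedge_mul (A C K : Matrix (Fin 2 ⊕ Fin m) (Fin 2 ⊕ Fin m) ℂ) :
    wedge (A * K) (C * K) = K.det • wedge A C := by
  have := AlternatingMap.map_sum_smul_eq_det_smul (exteriorPower.ιMulti ℂ (2 + m))
    (fun j => blockCol A C (finSumFinEquiv.symm j))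
    (K.submatrix finSumFinEquiv.symm finSumFinEquiv.symm)
  rw [Matrix.det_submatrix_equiv_self] at this
  rw [wedge, wedge, ← this]
  congr 1
  funext j
  rw [← finSumFinEquiv.sum_comp]
  funext r
  rcases r with r | r <;>
    simp [blockCol, Matrix.mul_apply, mul_comm, Finset.sum_apply]

/-- The Plücker coordinate with rows `ρ`. -/
noncomputable def rowDet (ρ : Fin 2 ⊕ Fin m → (Fin 2 ⊕ Fin m) ⊕ (Fin 2 ⊕ Fin m)) :
    Module.Dual ℂ (⋀[ℂ]^(2 + m) (SympSpace (2 + m))) :=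
  exteriorPower.alternatingMapLinearEquiv
    (((Matrix.detRowAlternating (R := ℂ) (n := Fin 2 ⊕ Fin m)).compLinearMap
      (LinearMap.funLeft ℂ ℂ fun i => Sum.map finSumFinEquiv finSumFinEquiv (ρ i))).domDomCongr
        finSumFinEquiv)

theorem rowDet_wedge (ρ : Fin 2 ⊕ Fin m → (Fin 2 ⊕ Fin m) ⊕ (Fin 2 ⊕ Fin m))
    (A C : Matrix (Fin 2 ⊕ Fin m) (Fin 2 ⊕ Fin m) ℂ) :
    rowDet ρ (wedge A C) = (Matrix.of fun i j => Matrix.fromRows A C (ρ i) j).det := by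
  rw [rowDet, wedge, exteriorPower.alternatingMapLinearEquiv_apply_ιMulti, ← Matrix.det_transpose]
  change Matrix.det _ = _
  congr 1
  ext j i
  rcases h : ρ i with r | r <;> simp [blockCol, LinearMap.funLeft, h]

/-- The Plücker coordinate of `e_1 ∧ ⋯ ∧ e_N`. -/
noncomputable def coord₀ (m : ℕ) : Module.Dual ℂ (⋀[ℂ]^(2 + m) (SympSpace (2 + m))) :=
  rowDet Sum.inl

/-- The Plücker coordinate of `e_1 ∧ ⋯ ∧ e_N` with `e_j` replaced by `e_{-k}`. -/
noncomputable def coord₁ (j k : Fin 2 ⊕ Fin m) :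
    Module.Dual ℂ (⋀[ℂ]^(2 + m) (SympSpace (2 + m))) :=
  rowDet (Function.update Sum.inl j (Sum.inr k))

/-- The Plücker coordinate of `e_{-j} ∧ e_{-k} ∧ e_3 ∧ ⋯ ∧ e_N`. -/
noncomputable def coord₂ (j k : Fin 2 ⊕ Fin m) :
    Module.Dual ℂ (⋀[ℂ]^(2 + m) (SympSpace (2 + m))) :=
  rowDet (Sum.elim ![Sum.inr j, Sum.inr k] fun i => Sum.inl (Sum.inr i))

theorem coord₀_wedge (A C : Matrix (Fin 2 ⊕ Fin m) (Fin 2 ⊕ Fin m) ℂ) :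
    coord₀ m (wedge A C) = A.det := by
  rw [coord₀, rowDet_wedge]
  rfl

theorem coord₁_wedge_one (S : Matrix (Fin 2 ⊕ Fin m) (Fin 2 ⊕ Fin m) ℂ)
    (j k : Fin 2 ⊕ Fin m) : coord₁ j k (wedge 1 S) = S k j := by
  have h : (Matrix.of fun i l => Matrix.fromRows (1 : Matrix (Fin 2 ⊕ Fin m) (Fin 2 ⊕ Fin m) ℂ) S
      (Function.update Sum.inl j (Sum.inr k) i) l) = (1 : Matrix _ _ ℂ).updateRow j (S k) := by
    ext i l
    by_cases hi : i = j
    · subst hi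
      simp
    · simp [hi]
  rw [coord₁, rowDet_wedge, h, ← Matrix.cramer_transpose_apply, Matrix.transpose_one,
    Matrix.cramer_one]
  rfl

theorem coord₀_wedge_of_zero {A C : Matrix (Fin 2 ⊕ Fin m) (Fin 2 ⊕ Fin m) ℂ}
    (hA : ∀ i b, A i (Sum.inl b) = 0) : coord₀ m (wedge A C) = 0 := by
  rw [coord₀_wedge]
  exact Matrix.det_eq_zero_of_column_eq_zero (Sum.inl 0) fun i => hA i 0

/-- Only one row of the minor comes from `C`, so its first two columns are supported in a single row
and are linearly dependent. -/
theorem coord₁_wedge_of_zero {A C : Matrix (Fin 2 ⊕ Fin m) (Fin 2 ⊕ Fin m) ℂ}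
    (hA : ∀ i b, A i (Sum.inl b) = 0) (j k : Fin 2 ⊕ Fin m) : coord₁ j k (wedge A C) = 0 := by
  rw [coord₁, rowDet_wedge]
  by_cases h : C k (Sum.inl 0) = 0
  · refine Matrix.det_eq_zero_of_column_eq_zero (Sum.inl 0) fun i => ?_
    by_cases hi : i = j
    · subst hi
      simp [h]
    · simp [hi, hA]
  · refine Matrix.exists_mulVec_eq_zero_iff.1
      ⟨Pi.single (Sum.inl 0) (C k (Sum.inl 1)) - Pi.single (Sum.inl 1) (C k (Sum.inl 0)),
        fun h0 => h ?_, ?_⟩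
    · simpa using congrFun h0 (Sum.inl 1)
    · funext i
      rw [Matrix.mulVec_sub]
      by_cases hi : i = j
      · subst hi
        simp [mul_comm]
      · simp [hi, hA]

theorem coord₂_wedge {A C : Matrix (Fin 2 ⊕ Fin m) (Fin 2 ⊕ Fin m) ℂ}
    (hA : ∀ i b, A (Sum.inr i) (Sum.inl b) = 0) (j k : Fin 2 ⊕ Fin m) :
    coord₂ j k (wedge A C) = (C j (Sum.inl 0) * C k (Sum.inl 1) -
      C j (Sum.inl 1) * C k (Sum.inl 0)) * A.toBlocks₂₂.det := by
  have h : (Matrix.of fun i l => Matrix.fromRows A C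
      (Sum.elim ![Sum.inr j, Sum.inr k] (fun i => Sum.inl (Sum.inr i)) i) l) =
      Matrix.fromBlocks !![C j (Sum.inl 0), C j (Sum.inl 1); C k (Sum.inl 0), C k (Sum.inl 1)]
        (Matrix.of ![fun l => C j (Sum.inr l), fun l => C k (Sum.inr l)]) 0 A.toBlocks₂₂ := by
    ext i l
    rcases i with i | i <;> rcases l with l | l
    · fin_cases i <;> fin_cases l <;> simp
    · fin_cases i <;> simp
    · simp [hA]
    · simp [Matrix.toBlocks₂₂]
  rw [coord₂, rowDet_wedge, h, Matrix.det_fromBlocks_zero₂₁, Matrix.det_fin_two_of]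

/-- A homogeneous quadratic polynomial in the Plücker coordinates that vanishes on the
Lagrangian Grassmannian. -/
noncomputable def quadric (j k : Fin 2 ⊕ Fin m) :
    MvPolynomial (Module.Dual ℂ (⋀[ℂ]^(2 + m) (SympSpace (2 + m)))) ℂ :=
  MvPolynomial.X (coord₀ m) * MvPolynomial.X (coord₂ j k) -
    (MvPolynomial.X (coord₁ (Sum.inl 0) j) * MvPolynomial.X (coord₁ (Sum.inl 1) k) -
      MvPolynomial.X (coord₁ (Sum.inl 1) j) * MvPolynomial.X (coord₁ (Sum.inl 0) k))

theorem quadric_isHomogeneous (j k : Fin 2 ⊕ Fin m) : (quadric j k).IsHomogeneous 2 :=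
  ((MvPolynomial.isHomogeneous_X _ _).mul (MvPolynomial.isHomogeneous_X _ _)).sub
    (((MvPolynomial.isHomogeneous_X _ _).mul (MvPolynomial.isHomogeneous_X _ _)).sub
      ((MvPolynomial.isHomogeneous_X _ _).mul (MvPolynomial.isHomogeneous_X _ _)))

/-- The `α ^ 2` terms cancel because the second-order coordinate of a graph is a `2 × 2` minor of
its first-order ones. There is no `β ^ 2` term, since `coord₀` and `coord₁` kill the second summand.
-/
theorem evalAt_quadric (S : Matrix (Fin 2 ⊕ Fin m) (Fin 2 ⊕ Fin m) ℂ)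
    {A C : Matrix (Fin 2 ⊕ Fin m) (Fin 2 ⊕ Fin m) ℂ} (hA : ∀ i b, A i (Sum.inl b) = 0)
    (α β : ℂ) (j k : Fin 2 ⊕ Fin m) :
    evalAt (quadric j k) (α • wedge 1 S + β • wedge A C) =
      α * β * ((C j (Sum.inl 0) * C k (Sum.inl 1) - C j (Sum.inl 1) * C k (Sum.inl 0)) *
        A.toBlocks₂₂.det) := by
  have h1 : ∀ (i : Fin m) (b : Fin 2), (1 : Matrix (Fin 2 ⊕ Fin m) (Fin 2 ⊕ Fin m) ℂ)
      (Sum.inr i) (Sum.inl b) = 0 := by simp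
  have h2 : (1 : Matrix (Fin 2 ⊕ Fin m) (Fin 2 ⊕ Fin m) ℂ).toBlocks₂₂.det = 1 := by
    rw [← Matrix.fromBlocks_one, Matrix.toBlocks_fromBlocks₂₂, Matrix.det_one]
  simp only [quadric, evalAt_sub, evalAt_mul, evalAt_X, map_add, map_smul, smul_eq_mul,
    coord₀_wedge_of_zero hA, coord₁_wedge_of_zero hA, coord₂_wedge (fun i b => hA _ b),
    coord₂_wedge h1, coord₁_wedge_one, h2]
  rw [coord₀_wedge, Matrix.det_one]
  ring

theorem evalAt_coord₀ (S : Matrix (Fin 2 ⊕ Fin m) (Fin 2 ⊕ Fin m) ℂ)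
    {A C : Matrix (Fin 2 ⊕ Fin m) (Fin 2 ⊕ Fin m) ℂ} (hA : ∀ i b, A i (Sum.inl b) = 0)
    (α β : ℂ) : coord₀ m (α • wedge 1 S + β • wedge A C) = α := by
  simp [coord₀_wedge_of_zero hA, coord₀_wedge]

theorem evalAt_coord₁ (S : Matrix (Fin 2 ⊕ Fin m) (Fin 2 ⊕ Fin m) ℂ)
    {A C : Matrix (Fin 2 ⊕ Fin m) (Fin 2 ⊕ Fin m) ℂ} (hA : ∀ i b, A i (Sum.inl b) = 0)
    (α β : ℂ) (j k : Fin 2 ⊕ Fin m) :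
    coord₁ j k (α • wedge 1 S + β • wedge A C) = α * S k j := by
  simp [coord₁_wedge_of_zero hA, coord₁_wedge_one]

theorem exists_polynomial_multilinear {σ κ : Type*} [Fintype κ] [DecidableEq κ] {n : ℕ}
    (f : MultilinearMap ℂ (fun _ : Fin n => κ → ℂ) ℂ) (c : Fin n → κ → MvPolynomial σ ℂ) :
    ∃ P : MvPolynomial σ ℂ, ∀ a,
      f (fun j r => MvPolynomial.eval a (c j r)) = MvPolynomial.eval a P := by
  refine ⟨∑ r : Fin n → κ, (∏ j, c j (r j)) *
    MvPolynomial.C (f fun j => Pi.single (r j) 1), fun a => ?_⟩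
  have h : (fun (j : Fin n) (r : κ) => MvPolynomial.eval a (c j r)) =
      fun j => ∑ r, MvPolynomial.eval a (c j r) • (Pi.single r 1 : κ → ℂ) := by
    funext j r
    simp [Finset.sum_apply, Pi.single_apply]
  rw [h, MultilinearMap.map_sum]
  simp only [MultilinearMap.map_smul_univ, map_sum, map_mul, map_prod, MvPolynomial.eval_C,
    smul_eq_mul]

theorem exists_polynomial_wedge {σ : Type*}
    (ℓ : Module.Dual ℂ (⋀[ℂ]^(2 + m) (SympSpace (2 + m))))
    (A C : Matrix (Fin 2 ⊕ Fin m) (Fin 2 ⊕ Fin m) (MvPolynomial σ ℂ)) :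
    ∃ P : MvPolynomial σ ℂ, ∀ a : σ → ℂ,
      ℓ (wedge (A.map (MvPolynomial.eval a)) (C.map (MvPolynomial.eval a))) =
        MvPolynomial.eval a P := by
  obtain ⟨P, hP⟩ := exists_polynomial_multilinear
    (ℓ.compMultilinearMap (exteriorPower.ιMulti ℂ (2 + m) (M := SympSpace (2 + m))).toMultilinearMap)
    (fun j r => Sum.elim (fun i => A (finSumFinEquiv.symm i) (finSumFinEquiv.symm j))
      (fun i => C (finSumFinEquiv.symm i) (finSumFinEquiv.symm j)) r)
  refine ⟨P, fun a => ?_⟩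
  rw [← hP]
  change ℓ _ = ℓ _
  congr 1
  rw [wedge]
  change _ = exteriorPower.ιMulti ℂ (2 + m) _
  congr 1
  funext j r
  rcases r with r | r <;> rfl

end WedgeCoordinates

/-! ### The symplectic action in block form and the inclusion in the secant variety -/

section SymplecticOrbit

open Matrix

theorem mk_mem_secantOrbit {N s : ℕ} {v : ⋀[ℂ]^N (SympSpace N)} (hv : v ≠ 0) :
    Projectivization.mk ℂ v hv ∈ secantOrbit N s ↔
      ∃ g ∈ symplecticGroup (Fin N) ℂ, ∃ t : ℂ, t ≠ 0 ∧
        v = t • exteriorPower.map N (mulVecLin g) (secantVector N s) := by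
  simp only [secantOrbit, Set.mem_ofPred_eq, Projectivization.submodule_mk]
  refine exists_congr fun g => and_congr_right fun _ => ?_
  rw [eq_comm, Submodule.span_singleton_eq_span_singleton]
  constructor
  · rintro ⟨z, hz⟩
    exact ⟨z, z.ne_zero, hz.symm⟩
  · rintro ⟨t, ht, h⟩
    exact ⟨Units.mk0 t ht, h.symm⟩

theorem map_mulVecLin_mul {N : ℕ} (g h : Matrix (Fin N ⊕ Fin N) (Fin N ⊕ Fin N) ℂ)
    (v : ⋀[ℂ]^N (SympSpace N)) :
    exteriorPower.map N (mulVecLin (g * h)) v =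
      exteriorPower.map N (mulVecLin g) (exteriorPower.map N (mulVecLin h) v) := by
  rw [Matrix.mulVecLin_mul, exteriorPower.map_comp]
  rfl

theorem map_mulVecLin_one {N : ℕ} (v : ⋀[ℂ]^N (SympSpace N)) :
    exteriorPower.map N (mulVecLin (1 : Matrix (Fin N ⊕ Fin N) (Fin N ⊕ Fin N) ℂ)) v = v := by
  rw [Matrix.mulVecLin_one, exteriorPower.map_id]
  rfl

theorem map_mem_secantOrbit {N s : ℕ} {g : Matrix (Fin N ⊕ Fin N) (Fin N ⊕ Fin N) ℂ}
    (hg : g ∈ symplecticGroup (Fin N) ℂ) (v : ⋀[ℂ]^N (SympSpace N)) (hv : v ≠ 0)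
    (hgv : exteriorPower.map N (mulVecLin g) v ≠ 0)
    (h : Projectivization.mk ℂ v hv ∈ secantOrbit N s) :
    Projectivization.mk ℂ _ hgv ∈ secantOrbit N s := by
  obtain ⟨h, hh, t, ht, hvt⟩ := (mk_mem_secantOrbit hv).1 h
  refine (mk_mem_secantOrbit hgv).2 ⟨g * h, mul_mem hg hh, t, ht, ?_⟩
  rw [map_mulVecLin_mul, ← map_smul, ← hvt]

theorem sympForm_mulVec {N : ℕ} {g : Matrix (Fin N ⊕ Fin N) (Fin N ⊕ Fin N) ℂ}
    (hg : g ∈ symplecticGroup (Fin N) ℂ) (v w : SympSpace N) :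
    sympForm N (g *ᵥ v) (g *ᵥ w) = sympForm N v w := by
  have key : ∀ v w : SympSpace N, sympForm N v w = -(v ⬝ᵥ J (Fin N) ℂ *ᵥ w) := by
    intro v w
    simp [sympForm, J, Matrix.fromBlocks_mulVec, dotProduct, Fintype.sum_sum_type,
      Matrix.neg_mulVec, Finset.sum_sub_distrib]
    ring
  rw [key, key]
  conv_rhs => rw [← SymplecticGroup.mem_iff'.1 hg]
  rw [← Matrix.mulVec_mulVec, ← Matrix.mulVec_mulVec, Matrix.dotProduct_mulVec v gᵀ,
    Matrix.vecMul_transpose]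

theorem isotropic_mem_lagrangianGrassmannian {N : ℕ}
    {g : Matrix (Fin N ⊕ Fin N) (Fin N ⊕ Fin N) ℂ} (hg : g ∈ symplecticGroup (Fin N) ℂ)
    (σ : Fin N → Fin N ⊕ Fin N) (hσ : ∀ i, σ i = Sum.inl i ∨ σ i = Sum.inr i)
    (hne : exteriorPower.map N (mulVecLin g)
      (exteriorPower.ιMulti ℂ N fun i => (Pi.single (σ i) 1 : SympSpace N)) ≠ 0) :
    Projectivization.mk ℂ _ hne ∈ lagrangianGrassmannian N := by
  have hinj : Function.Injective σ := by
    intro i j hij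
    rcases hσ i with h | h <;> rcases hσ j with h' | h' <;> simp_all
  refine ⟨fun i => g *ᵥ (Pi.single (σ i) 1 : SympSpace N), ?_, fun i j => ?_, ?_⟩
  · have hdet := SymplecticGroup.symplectic_det hg
    have h1 : LinearIndependent ℂ fun i => (Pi.single (σ i) 1 : SympSpace N) := by
      have := (Pi.basisFun ℂ (Fin N ⊕ Fin N)).linearIndependent.comp σ hinj
      convert this using 2 with i
      simp
    refine h1.map' (mulVecLin g) (LinearMap.ker_eq_bot.2 ?_)
    exact Matrix.mulVec_injective_of_isUnit ((Matrix.isUnit_iff_isUnit_det g).2 hdet)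
  · rw [sympForm_mulVec hg]
    refine Finset.sum_eq_zero fun k _ => ?_
    rcases hσ i with h | h <;> rcases hσ j with h' | h' <;>
      simp [h, h', Pi.single_apply] <;> rintro rfl rfl <;> simp [h] at h'
  · rw [Projectivization.submodule_mk, exteriorPower.map_apply_ιMulti]
    rfl

variable {m : ℕ}

/-- A `2N × 2N` matrix with given blocks, the index set `{1, …, N}` being split as `2 + m`. -/
def blockMatrix (A B C D : Matrix (Fin 2 ⊕ Fin m) (Fin 2 ⊕ Fin m) ℂ) :
    Matrix (Fin (2 + m) ⊕ Fin (2 + m)) (Fin (2 + m) ⊕ Fin (2 + m)) ℂ :=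
  fromBlocks (A.submatrix finSumFinEquiv.symm finSumFinEquiv.symm)
    (B.submatrix finSumFinEquiv.symm finSumFinEquiv.symm)
    (C.submatrix finSumFinEquiv.symm finSumFinEquiv.symm)
    (D.submatrix finSumFinEquiv.symm finSumFinEquiv.symm)

theorem exists_eq_blockMatrix
    (g : Matrix (Fin (2 + m) ⊕ Fin (2 + m)) (Fin (2 + m) ⊕ Fin (2 + m)) ℂ) :
    ∃ A B C D, g = blockMatrix A B C D := by
  refine ⟨g.toBlocks₁₁.submatrix finSumFinEquiv finSumFinEquiv,
    g.toBlocks₁₂.submatrix finSumFinEquiv finSumFinEquiv,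
    g.toBlocks₂₁.submatrix finSumFinEquiv finSumFinEquiv,
    g.toBlocks₂₂.submatrix finSumFinEquiv finSumFinEquiv, ?_⟩
  simp [blockMatrix, Matrix.submatrix_submatrix, Matrix.fromBlocks_toBlocks]

theorem blockMatrix_mem_iff {A B C D : Matrix (Fin 2 ⊕ Fin m) (Fin 2 ⊕ Fin m) ℂ} :
    blockMatrix A B C D ∈ symplecticGroup (Fin (2 + m)) ℂ ↔
      Aᵀ * C = Cᵀ * A ∧ Bᵀ * D = Dᵀ * B ∧ Aᵀ * D - Cᵀ * B = 1 := by
  have hinj : Function.Injective fun M : Matrix (Fin 2 ⊕ Fin m) (Fin 2 ⊕ Fin m) ℂ =>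
      M.submatrix (finSumFinEquiv (m := 2) (n := m)).symm finSumFinEquiv.symm :=
    (Matrix.reindex finSumFinEquiv finSumFinEquiv).injective
  rw [blockMatrix, SymplecticGroup.fromBlocks_mem_iff]
  simp only [Matrix.transpose_submatrix, Matrix.submatrix_mul_equiv]
  refine and_congr hinj.eq_iff (and_congr hinj.eq_iff ?_)
  rw [← hinj.eq_iff (a := Aᵀ * D - Cᵀ * B)]
  simp [Matrix.submatrix_sub]

/-- The symplectic group is stable under transposition. This relation makes `A⁻¹ * B` symmetric in
the normal form. -/
theorem blockMatrix_mem_transpose {A B C D : Matrix (Fin 2 ⊕ Fin m) (Fin 2 ⊕ Fin m) ℂ}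
    (h : blockMatrix A B C D ∈ symplecticGroup (Fin (2 + m)) ℂ) : A * Bᵀ = B * Aᵀ := by
  have h' : blockMatrix Aᵀ Cᵀ Bᵀ Dᵀ ∈ symplecticGroup (Fin (2 + m)) ℂ := by
    have := SymplecticGroup.transpose_mem h
    rwa [blockMatrix, Matrix.fromBlocks_transpose] at this
  simpa using (blockMatrix_mem_iff.1 h').1

theorem blockMatrix_mul (A B C D A' B' C' D' : Matrix (Fin 2 ⊕ Fin m) (Fin 2 ⊕ Fin m) ℂ) :
    blockMatrix A B C D * blockMatrix A' B' C' D' =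
      blockMatrix (A * A' + B * C') (A * B' + B * D') (C * A' + D * C') (C * B' + D * D') := by
  simp [blockMatrix, Matrix.fromBlocks_multiply, Matrix.submatrix_add]

theorem blockCol_mul (A C K : Matrix (Fin 2 ⊕ Fin m) (Fin 2 ⊕ Fin m) ℂ) (j : Fin 2 ⊕ Fin m) :
    blockCol (A * K) (C * K) j = ∑ i, K i j • blockCol A C i := by
  funext r
  rcases r with r | r <;> simp [blockCol, Matrix.mul_apply, mul_comm, Finset.sum_apply]

theorem map_blockMatrix_wedge (A B C D P Q : Matrix (Fin 2 ⊕ Fin m) (Fin 2 ⊕ Fin m) ℂ) :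
    exteriorPower.map (2 + m) (mulVecLin (blockMatrix A B C D)) (wedge P Q) =
      wedge (A * P + B * Q) (C * P + D * Q) := by
  rw [wedge, exteriorPower.map_apply_ιMulti, wedge]
  congr 1
  funext j r
  have aux : ∀ (M L : Matrix (Fin 2 ⊕ Fin m) (Fin 2 ⊕ Fin m) ℂ) (i : Fin (2 + m))
      (j : Fin 2 ⊕ Fin m), ((M.submatrix finSumFinEquiv.symm finSumFinEquiv.symm) *ᵥ
        fun k : Fin (2 + m) => L (finSumFinEquiv.symm k) j) i =
          (M * L) (finSumFinEquiv.symm i) j := by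
    intro M L i j
    rw [Matrix.mulVec, dotProduct, Matrix.mul_apply, ← finSumFinEquiv.sum_comp]
    simp
  rcases r with r | r <;>
    simp [blockMatrix, blockCol, Matrix.fromBlocks_mulVec, Function.comp_def, aux]

/-- The projection to the span of `e_3, …, e_N`. -/
def tailProj (m : ℕ) : Matrix (Fin 2 ⊕ Fin m) (Fin 2 ⊕ Fin m) ℂ := fromBlocks 0 0 0 1

/-- The projection to the span of `e_1, e_2`. -/
def headProj (m : ℕ) : Matrix (Fin 2 ⊕ Fin m) (Fin 2 ⊕ Fin m) ℂ := fromBlocks 1 0 0 0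

theorem wedge_one_zero : wedge (1 : Matrix (Fin 2 ⊕ Fin m) (Fin 2 ⊕ Fin m) ℂ) 0 =
    exteriorPower.ιMulti ℂ (2 + m) fun i => (Pi.single (Sum.inl i) 1 : SympSpace (2 + m)) := by
  rw [wedge]
  congr 1
  funext j r
  rcases r with r | r <;> simp [blockCol, Matrix.one_apply, Pi.single_apply]

theorem wedge_tailProj_headProj : wedge (tailProj m) (headProj m) =
    exteriorPower.ιMulti ℂ (2 + m) fun i => (Pi.single
      (if (i : ℕ) < 2 then Sum.inr i else Sum.inl i) 1 : SympSpace (2 + m)) := by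
  rw [wedge]
  congr 1
  funext j r
  obtain ⟨j, rfl⟩ := finSumFinEquiv.surjective j
  obtain ⟨r, rfl⟩ := (finSumFinEquiv.sumCongr finSumFinEquiv).surjective r
  rcases j with j | j
  · have hj : ((finSumFinEquiv (Sum.inl j : Fin 2 ⊕ Fin m) : Fin (2 + m)) : ℕ) < 2 := by
      simp only [finSumFinEquiv_apply_left, Fin.val_castAdd]
      omega
    rw [if_pos hj]
    rcases r with (r | r) | (r | r) <;>
      simp [blockCol, tailProj, headProj, Matrix.one_apply, Pi.single_apply, Fin.ext_iff]
    omega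
  · have hj : ¬ ((finSumFinEquiv (Sum.inr j : Fin 2 ⊕ Fin m) : Fin (2 + m)) : ℕ) < 2 := by
      simp only [finSumFinEquiv_apply_right, Fin.val_natAdd]
      omega
    rw [if_neg hj]
    rcases r with (r | r) | (r | r) <;>
      simp [blockCol, tailProj, headProj, Matrix.one_apply, Pi.single_apply, Fin.ext_iff]
    omega

theorem secantVector_eq_wedge :
    secantVector (2 + m) 2 = wedge 1 0 + wedge (tailProj m) (headProj m) := by
  rw [wedge_one_zero, wedge_tailProj_headProj, secantVector]

theorem map_blockMatrix_secantVector (A B C D : Matrix (Fin 2 ⊕ Fin m) (Fin 2 ⊕ Fin m) ℂ) :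
    exteriorPower.map (2 + m) (mulVecLin (blockMatrix A B C D)) (secantVector (2 + m) 2) =
      wedge A C + wedge (A * tailProj m + B * headProj m) (C * tailProj m + D * headProj m) := by
  rw [secantVector_eq_wedge, map_add, map_blockMatrix_wedge, map_blockMatrix_wedge]
  simp

theorem secantOrbit_subset_secantVariety (m : ℕ) :
    secantOrbit (2 + m) 2 ⊆ secantVariety (lagrangianGrassmannian (2 + m)) := by
  rintro x ⟨g, hg, hx⟩
  refine @subset_closure _ (zariskiTopology _) _ _ ?_
  have hinj : Function.Injective (exteriorPower.map (2 + m) (mulVecLin g)) := by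
    refine exteriorPower.map_injective_field ?_
    exact Matrix.mulVec_injective_of_isUnit
      ((Matrix.isUnit_iff_isUnit_det g).2 (SymplecticGroup.symplectic_det hg))
  have h1 : wedge (1 : Matrix (Fin 2 ⊕ Fin m) (Fin 2 ⊕ Fin m) ℂ) 0 ≠ 0 := by
    intro h
    have := congrArg (coord₀ m) h
    rw [coord₀_wedge, map_zero, det_one] at this
    exact one_ne_zero this
  have h2 : wedge (tailProj m) (headProj m) ≠ 0 := by
    intro h
    have := congrArg (coord₂ (Sum.inl 0) (Sum.inl 1)) h
    rw [coord₂_wedge (by simp [tailProj]), map_zero] at this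
    simp [tailProj, headProj] at this
  rw [secantVector_eq_wedge, map_add] at hx
  have h1' := (map_ne_zero_iff _ hinj).2 h1
  have h2' := (map_ne_zero_iff _ hinj).2 h2
  refine ⟨Projectivization.mk ℂ _ h1', ?_, Projectivization.mk ℂ _ h2', ?_, ?_⟩
  · simp only [wedge_one_zero]
    exact isotropic_mem_lagrangianGrassmannian hg _ (fun i => Or.inl rfl) _
  · simp only [wedge_tailProj_headProj]
    refine isotropic_mem_lagrangianGrassmannian hg _ (fun i => ?_) _
    by_cases hi : (i : ℕ) < 2 <;> simp [hi]
  · rw [hx, Submodule.span_singleton_le_iff_mem, Projectivization.submodule_mk,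
      Projectivization.submodule_mk]
    exact Submodule.add_mem_sup (Submodule.mem_span_singleton_self _)
      (Submodule.mem_span_singleton_self _)

end SymplecticOrbit

/-! ### Normal form of a sum of two Lagrangian wedges -/

section OrbitChart

open Matrix

variable {m : ℕ}

/-- The wedge product of two vectors and the last `m` columns of a block matrix. -/
noncomputable def headWedge (A C : Matrix (Fin 2 ⊕ Fin m) (Fin 2 ⊕ Fin m) ℂ) :
    SympSpace (2 + m) →ₗ[ℂ] SympSpace (2 + m) →ₗ[ℂ] ⋀[ℂ]^(2 + m) (SympSpace (2 + m)) :=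
  LinearMap.mk₂ ℂ
    (fun u w => ((exteriorPower.ιMulti ℂ (2 + m)).domDomCongr finSumFinEquiv.symm)
      (Function.update (Function.update (blockCol A C) (Sum.inl 0) u) (Sum.inl 1) w))
    (fun u u' w => by
      simp only [Function.update_comm (show (Sum.inl 0 : Fin 2 ⊕ Fin m) ≠ Sum.inl 1 by simp),
        AlternatingMap.map_update_add])
    (fun c u w => by
      simp only [Function.update_comm (show (Sum.inl 0 : Fin 2 ⊕ Fin m) ≠ Sum.inl 1 by simp),
        AlternatingMap.map_update_smul])
    (fun u w w' => AlternatingMap.map_update_add _ _ _ _ _)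
    (fun c u w => AlternatingMap.map_update_smul _ _ _ _ _)

theorem headWedge_apply (A C : Matrix (Fin 2 ⊕ Fin m) (Fin 2 ⊕ Fin m) ℂ)
    (u w : SympSpace (2 + m)) : headWedge A C u w =
      ((exteriorPower.ιMulti ℂ (2 + m)).domDomCongr finSumFinEquiv.symm)
        (Function.update (Function.update (blockCol A C) (Sum.inl 0) u) (Sum.inl 1) w) := rfl

theorem wedge_eq_headWedge {A C P Q : Matrix (Fin 2 ⊕ Fin m) (Fin 2 ⊕ Fin m) ℂ}
    (h : ∀ i, blockCol P Q (Sum.inr i) = blockCol A C (Sum.inr i)) :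
    wedge P Q = headWedge A C (blockCol P Q (Sum.inl 0)) (blockCol P Q (Sum.inl 1)) := by
  rw [headWedge_apply, wedge]
  change exteriorPower.ιMulti ℂ (2 + m) _ = exteriorPower.ιMulti ℂ (2 + m) _
  congr 1
  funext j
  obtain ⟨j, rfl⟩ := finSumFinEquiv.surjective j
  rcases j with j | j
  · fin_cases j <;> simp
  · simp [h]

theorem headWedge_self (A C : Matrix (Fin 2 ⊕ Fin m) (Fin 2 ⊕ Fin m) ℂ)
    (u : SympSpace (2 + m)) : headWedge A C u u = 0 := by
  rw [headWedge_apply]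
  exact AlternatingMap.map_eq_zero_of_eq _ _ (i := Sum.inl 0) (j := Sum.inl 1) (by simp) (by simp)

theorem headWedge_inr_left (A C : Matrix (Fin 2 ⊕ Fin m) (Fin 2 ⊕ Fin m) ℂ)
    (i : Fin m) (w : SympSpace (2 + m)) : headWedge A C (blockCol A C (Sum.inr i)) w = 0 := by
  rw [headWedge_apply]
  exact AlternatingMap.map_eq_zero_of_eq _ _ (i := Sum.inl 0) (j := Sum.inr i) (by simp) (by simp)

theorem headWedge_inr_right (A C : Matrix (Fin 2 ⊕ Fin m) (Fin 2 ⊕ Fin m) ℂ)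
    (i : Fin m) (w : SympSpace (2 + m)) : headWedge A C w (blockCol A C (Sum.inr i)) = 0 := by
  rw [headWedge_apply]
  exact AlternatingMap.map_eq_zero_of_eq _ _ (i := Sum.inl 1) (j := Sum.inr i) (by simp) (by simp)

/-- The coefficient of `β a₀ a₁` on the left is `c = 1 + (p * r - q * q)`. Completing the square
absorbs the mixed `a`-`n` terms into `c • β a₀' a₁'`, the shifts being the adjugate of the symmetric
matrix `(p, q; q, r)` divided by `c`. The rest has coefficient `1 - (c - 1) / c = c⁻¹` on `β n₀ n₁`.
-/
theorem LinearMap.add_alternating_expansion {E F : Type*} [AddCommGroup E] [Module ℂ E]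
    [AddCommGroup F] [Module ℂ F] (β : E →ₗ[ℂ] E →ₗ[ℂ] F) (hβ : ∀ u, β u u = 0)
    (a₀ a₁ n₀ n₁ : E) (p q r : ℂ) (hc : 1 + (p * r - q * q) ≠ 0) :
    β a₀ a₁ + β (p • a₀ + q • a₁ + n₀) (q • a₀ + r • a₁ + n₁) =
      (1 + (p * r - q * q)) •
        β (a₀ + ((r / (1 + (p * r - q * q))) • n₀ + (-q / (1 + (p * r - q * q))) • n₁))
          (a₁ + ((-q / (1 + (p * r - q * q))) • n₀ + (p / (1 + (p * r - q * q))) • n₁)) +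
      (1 + (p * r - q * q))⁻¹ • β n₀ n₁ := by
  have hs : ∀ u w, β u w = -β w u := by
    intro u w
    have := hβ (u + w)
    simp only [map_add, LinearMap.add_apply, hβ, zero_add, add_zero] at this
    exact eq_neg_of_add_eq_zero_right this
  set c := 1 + (p * r - q * q) with hcdef
  simp only [map_add, LinearMap.add_apply, map_smul, LinearMap.smul_apply, hβ, hs a₁ a₀,
    hs n₀ a₀, hs n₀ a₁, hs n₁ a₁, hs n₁ n₀]
  have hq : p * r = c - 1 + q * q := by rw [hcdef]; ring
  match_scalars <;> field_simp <;> grind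

theorem blockCol_add (A C A' C' : Matrix (Fin 2 ⊕ Fin m) (Fin 2 ⊕ Fin m) ℂ)
    (j : Fin 2 ⊕ Fin m) :
    blockCol (A + A') (C + C') j = blockCol A C j + blockCol A' C' j := by
  funext r
  rcases r with r | r <;> rfl

theorem blockCol_mul_headProj_inl (A C : Matrix (Fin 2 ⊕ Fin m) (Fin 2 ⊕ Fin m) ℂ) (b : Fin 2) :
    blockCol (A * headProj m) (C * headProj m) (Sum.inl b) = blockCol A C (Sum.inl b) := by
  rw [blockCol_mul]
  simp [headProj, Matrix.one_apply]

theorem blockCol_mul_headProj_inr (A C : Matrix (Fin 2 ⊕ Fin m) (Fin 2 ⊕ Fin m) ℂ) (i : Fin m) :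
    blockCol (A * headProj m) (C * headProj m) (Sum.inr i) = 0 := by
  rw [blockCol_mul]
  simp [headProj]

theorem blockCol_mul_tailProj_inl (A C : Matrix (Fin 2 ⊕ Fin m) (Fin 2 ⊕ Fin m) ℂ) (b : Fin 2) :
    blockCol (A * tailProj m) (C * tailProj m) (Sum.inl b) = 0 := by
  rw [blockCol_mul]
  simp [tailProj]

theorem blockCol_mul_tailProj_inr (A C : Matrix (Fin 2 ⊕ Fin m) (Fin 2 ⊕ Fin m) ℂ) (i : Fin m) :
    blockCol (A * tailProj m) (C * tailProj m) (Sum.inr i) = blockCol A C (Sum.inr i) := by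
  rw [blockCol_mul]
  simp [tailProj, Matrix.one_apply]

theorem wedge_add_wedge (A C A' C' T : Matrix (Fin 2 ⊕ Fin m) (Fin 2 ⊕ Fin m) ℂ)
    (hT : Tᵀ = T) {c : ℂ} (hc : c ≠ 0) (hcT : c = 1 + T.toBlocks₁₁.det) :
    ∃ σ : Matrix (Fin 2 ⊕ Fin m) (Fin 2 ⊕ Fin m) ℂ, σᵀ = σ ∧ σ * tailProj m = 0 ∧
      wedge A C + wedge (A * (tailProj m + T * headProj m) + A' * headProj m)
          (C * (tailProj m + T * headProj m) + C' * headProj m) =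
        c • wedge (A + A' * σ) (C + C' * σ) +
          c⁻¹ • wedge (A * tailProj m + A' * headProj m) (C * tailProj m + C' * headProj m) := by
  have hsym : T (Sum.inl 1) (Sum.inl 0) = T (Sum.inl 0) (Sum.inl 1) :=
    congrFun (congrFun hT (Sum.inl 0)) (Sum.inl 1)
  have hcT' : c = 1 + (T (Sum.inl 0) (Sum.inl 0) * T (Sum.inl 1) (Sum.inl 1) -
      T (Sum.inl 0) (Sum.inl 1) * T (Sum.inl 0) (Sum.inl 1)) := by
    rw [hcT, Matrix.det_fin_two]
    simp [Matrix.toBlocks₁₁, hsym]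
  -- The adjugate of the upper left block of `T`, divided by `c`. The rest of `T` is irrelevant: it
  -- adds tail columns, already present in the wedge.
  let σ : Matrix (Fin 2 ⊕ Fin m) (Fin 2 ⊕ Fin m) ℂ := fromBlocks
    !![T (Sum.inl 1) (Sum.inl 1) / c, -T (Sum.inl 0) (Sum.inl 1) / c;
      -T (Sum.inl 0) (Sum.inl 1) / c, T (Sum.inl 0) (Sum.inl 0) / c] 0 0 0
  refine ⟨σ, ?_, ?_, ?_⟩
  · simp only [σ, Matrix.fromBlocks_transpose, Matrix.transpose_zero]
    congr 1
    ext i j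
    fin_cases i <;> fin_cases j <;> rfl
  · simp [σ, tailProj, Matrix.fromBlocks_multiply]
  · rw [wedge_eq_headWedge (A := A) (C := C) (fun i => rfl),
      wedge_eq_headWedge (A := A) (C := C) (P := A * (tailProj m + T * headProj m) + _),
      wedge_eq_headWedge (A := A) (C := C) (P := A + A' * σ),
      wedge_eq_headWedge (A := A) (C := C) (P := A * tailProj m + _)]
    · simp only [Matrix.mul_add, ← Matrix.mul_assoc, blockCol_add, blockCol_mul_headProj_inl,
        blockCol_mul_tailProj_inl, zero_add]
      rw [blockCol_mul A C T, blockCol_mul A C T, blockCol_mul A' C' σ, blockCol_mul A' C' σ]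
      simp only [Fintype.sum_sum_type, Fin.sum_univ_two, map_add, LinearMap.add_apply, map_sum,
        LinearMap.sum_apply, map_smul, LinearMap.smul_apply, headWedge_inr_left,
        headWedge_inr_right, smul_zero, Finset.sum_const_zero, add_zero, hsym]
      have := LinearMap.add_alternating_expansion (headWedge A C) (headWedge_self A C)
        (blockCol A C (Sum.inl 0)) (blockCol A C (Sum.inl 1))
        (blockCol A' C' (Sum.inl 0)) (blockCol A' C' (Sum.inl 1))
        (T (Sum.inl 0) (Sum.inl 0)) (T (Sum.inl 0) (Sum.inl 1)) (T (Sum.inl 1) (Sum.inl 1))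
        (by rwa [← hcT'])
      rw [← hcT'] at this
      simp only [map_add, LinearMap.add_apply, map_smul, LinearMap.smul_apply] at this
      simpa [σ] using this
    · intro i
      rw [blockCol_add, blockCol_mul_headProj_inr, blockCol_mul_tailProj_inr, add_zero]
    · intro i
      rw [blockCol_add, blockCol_mul]
      simp [σ]
    · intro i
      rw [blockCol_add, Matrix.mul_add, Matrix.mul_add, blockCol_add, ← Matrix.mul_assoc,
        ← Matrix.mul_assoc, blockCol_mul_headProj_inr, blockCol_mul_headProj_inr,
        blockCol_mul_tailProj_inr, add_zero, add_zero]

/-- Normal form of a point of the orbit whose first Plücker coordinate does not vanish, the first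
of the two Lagrangian subspaces being a graph. -/
theorem exists_graph_form {A B C D : Matrix (Fin 2 ⊕ Fin m) (Fin 2 ⊕ Fin m) ℂ}
    (hg : blockMatrix A B C D ∈ symplecticGroup (Fin (2 + m)) ℂ) (hA : A.det ≠ 0)
    (h₀ : coord₀ m (wedge A C +
      wedge (A * tailProj m + B * headProj m) (C * tailProj m + D * headProj m)) ≠ 0) :
    ∃ (S Y : Matrix (Fin 2 ⊕ Fin m) (Fin 2 ⊕ Fin m) ℂ) (c : ℂ), Sᵀ = S ∧ A * Y = 1 ∧ c ≠ 0 ∧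
      wedge A C + wedge (A * tailProj m + B * headProj m) (C * tailProj m + D * headProj m) =
        (c * A.det) • wedge 1 S +
          c⁻¹ • wedge (A * tailProj m) (S * (A * tailProj m) + Yᵀ * headProj m) := by
  obtain ⟨hAC, -, hAD⟩ := blockMatrix_mem_iff.1 hg
  have hAB := blockMatrix_mem_transpose hg
  have hYA : A⁻¹ * A = 1 := Matrix.nonsing_inv_mul A (Ne.isUnit hA)
  have hAY : A * A⁻¹ = 1 := Matrix.mul_nonsing_inv A (Ne.isUnit hA)
  generalize A⁻¹ = Y at hYA hAY
  have hYtAt : Yᵀ * Aᵀ = 1 := by rw [← Matrix.transpose_mul, hAY, Matrix.transpose_one]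
  have hAtYt : Aᵀ * Yᵀ = 1 := by rw [← Matrix.transpose_mul, hYA, Matrix.transpose_one]
  have hS : (C * Y)ᵀ = C * Y := by
    calc (C * Y)ᵀ = Yᵀ * (Cᵀ * A) * Y := by
          rw [Matrix.transpose_mul, Matrix.mul_assoc, Matrix.mul_assoc, hAY, Matrix.mul_one]
      _ = C * Y := by rw [← hAC, ← Matrix.mul_assoc, hYtAt, Matrix.one_mul]
  have hT : (Y * B)ᵀ = Y * B := by
    calc (Y * B)ᵀ = Y * (A * Bᵀ) * Yᵀ := by
          rw [Matrix.transpose_mul, ← Matrix.mul_assoc Y A, hYA, Matrix.one_mul]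
      _ = Y * B := by rw [hAB, Matrix.mul_assoc, Matrix.mul_assoc, hAtYt, Matrix.mul_one]
  have hB : B = A * (Y * B) := by rw [← Matrix.mul_assoc, hAY, Matrix.one_mul]
  have hD : D = C * (Y * B) + Yᵀ := by
    calc D = Yᵀ * (Aᵀ * D) := by rw [← Matrix.mul_assoc, hYtAt, Matrix.one_mul]
      _ = Yᵀ * (1 + Cᵀ * B) := by rw [← hAD]; congr 1; abel
      _ = (C * Y)ᵀ * B + Yᵀ := by
        rw [Matrix.mul_add, Matrix.mul_one, Matrix.transpose_mul, Matrix.mul_assoc, add_comm]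
      _ = _ := by rw [hS, Matrix.mul_assoc]
  generalize Y * B = T at hT hB hD
  have e1 : A * tailProj m + B * headProj m =
      A * (tailProj m + T * headProj m) + 0 * headProj m := by
    rw [hB, Matrix.mul_add, Matrix.mul_assoc, Matrix.zero_mul, add_zero]
  have e2 : C * tailProj m + D * headProj m =
      C * (tailProj m + T * headProj m) + Yᵀ * headProj m := by
    rw [hD, Matrix.mul_add, Matrix.add_mul, Matrix.mul_assoc, add_assoc]
  have hdet : (tailProj m + T * headProj m).det = T.toBlocks₁₁.det := by
    have : tailProj m + T * headProj m = fromBlocks T.toBlocks₁₁ 0 T.toBlocks₂₁ 1 := by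
      conv_lhs => rw [← Matrix.fromBlocks_toBlocks T]
      simp [tailProj, headProj, Matrix.fromBlocks_multiply, Matrix.fromBlocks_add]
    rw [this, Matrix.det_fromBlocks_zero₁₂, Matrix.det_one, mul_one]
  -- The first Plücker coordinate of the sum is `A.det * (1 + T.toBlocks₁₁.det)`.
  have hc : 1 + T.toBlocks₁₁.det ≠ 0 := by
    intro h
    apply h₀
    rw [map_add, coord₀_wedge, coord₀_wedge, e1, Matrix.zero_mul, add_zero, Matrix.det_mul, hdet]
    linear_combination A.det * h
  obtain ⟨σ, hσ, hσt, hw⟩ := wedge_add_wedge A C 0 Yᵀ T hT hc rfl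
  have hSA : (C * Y + Yᵀ * σ * Y) * A = C + Yᵀ * σ := by
    rw [Matrix.add_mul, Matrix.mul_assoc, hYA, Matrix.mul_one, Matrix.mul_assoc (Yᵀ * σ), hYA,
      Matrix.mul_one]
  -- The graph of `C * Y` is sheared by `σ`. Since `σ * tailProj m = 0`, the new graph still
  -- contains the common tail columns.
  refine ⟨C * Y + Yᵀ * σ * Y, Y, 1 + T.toBlocks₁₁.det, ?_, hAY, hc, ?_⟩
  · rw [Matrix.transpose_add, hS, Matrix.transpose_mul, Matrix.transpose_mul, hσ,
      Matrix.transpose_transpose, Matrix.mul_assoc]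
  · rw [e1, e2, hw, mul_smul, ← wedge_mul, Matrix.one_mul, hSA, ← Matrix.mul_assoc, hSA,
      Matrix.add_mul, Matrix.mul_assoc Yᵀ, hσt, Matrix.zero_mul, Matrix.zero_mul, Matrix.mul_zero,
      add_zero, add_zero, add_zero]

end OrbitChart

/-! ### The chart of the orbit and its dimension -/

section OrbitDimension

open Matrix

variable {m : ℕ}

/-- The index set of the parameters: a symmetric `N × N` matrix, a `2 × (N - 2)` matrix and a
scalar. -/
abbrev OrbitIndex (m : ℕ) : Type := Sym2 (Fin 2 ⊕ Fin m) ⊕ (Fin 2 × Fin m) ⊕ Unit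

theorem card_orbitIndex (m : ℕ) : Fintype.card (OrbitIndex m) =
    (2 + m) * (2 + m + 1) / 2 + 2 * (2 + m) - 3 := by
  have h : (2 + m + 1).choose 2 = (2 + m) * (2 + m + 1) / 2 := by
    rw [Nat.choose_two_right, Nat.add_sub_cancel, mul_comm]
  simp only [Fintype.card_sum, Fintype.card_prod, Sym2.card, Fintype.card_fin, Fintype.card_unit, h]
  omega

/-- The symmetric matrix with given entries. -/
def symmMatrix {R : Type*} (a : OrbitIndex m → R) :
    Matrix (Fin 2 ⊕ Fin m) (Fin 2 ⊕ Fin m) R := of fun i j => a (Sum.inl s(i, j))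

/-- The `2 × (N - 2)` matrix with given entries. -/
def rectMatrix {R : Type*} (a : OrbitIndex m → R) : Matrix (Fin 2) (Fin m) R :=
  of fun b i => a (Sum.inr (Sum.inl (b, i)))

/-- The matrix whose columns are `0, 0` and the vectors `e_i + ∑ x_{bi} e_b` for `i ≥ 3`. -/
def tailMatrix {R : Type*} [CommRing R] (x : Matrix (Fin 2) (Fin m) R) :
    Matrix (Fin 2 ⊕ Fin m) (Fin 2 ⊕ Fin m) R := fromBlocks 0 x 0 1

/-- The matrix whose columns are `f_b - ∑ x_{bi} f_i` for `b = 1, 2`, followed by zeros. -/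
def headMatrix {R : Type*} [CommRing R] (x : Matrix (Fin 2) (Fin m) R) :
    Matrix (Fin 2 ⊕ Fin m) (Fin 2 ⊕ Fin m) R := fromBlocks 1 0 (-xᵀ) 0

/-- The parametrization of an open subset of the affine cone over the orbit, up to scalars. -/
noncomputable def orbitPoint (S : Matrix (Fin 2 ⊕ Fin m) (Fin 2 ⊕ Fin m) ℂ)
    (x : Matrix (Fin 2) (Fin m) ℂ) (q : ℂ) : ⋀[ℂ]^(2 + m) (SympSpace (2 + m)) :=
  wedge 1 S + q • wedge (tailMatrix x) (S * tailMatrix x + headMatrix x)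

theorem exists_polynomial_orbitPoint
    (ℓ : Module.Dual ℂ (⋀[ℂ]^(2 + m) (SympSpace (2 + m)))) :
    ∃ P : MvPolynomial (OrbitIndex m) ℂ, ∀ a,
      ℓ (orbitPoint (symmMatrix a) (rectMatrix a) (a (Sum.inr (Sum.inr ())))) =
        MvPolynomial.eval a P := by
  let S : Matrix (Fin 2 ⊕ Fin m) (Fin 2 ⊕ Fin m) (MvPolynomial (OrbitIndex m) ℂ) :=
    symmMatrix MvPolynomial.X
  let x : Matrix (Fin 2) (Fin m) (MvPolynomial (OrbitIndex m) ℂ) := rectMatrix MvPolynomial.X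
  obtain ⟨P, hP⟩ := exists_polynomial_wedge ℓ 1 S
  obtain ⟨Q, hQ⟩ := exists_polynomial_wedge ℓ (tailMatrix x) (S * tailMatrix x + headMatrix x)
  refine ⟨P + MvPolynomial.X (Sum.inr (Sum.inr ())) * Q, fun a => ?_⟩
  have hS : S.map (MvPolynomial.eval a) = symmMatrix a := by
    ext i j
    simp [S, symmMatrix]
  have hx : x.map (MvPolynomial.eval a) = rectMatrix a := by
    ext i j
    simp [x, rectMatrix]
  have ht : (tailMatrix x).map (MvPolynomial.eval a) = tailMatrix (rectMatrix a) := by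
    rw [tailMatrix, Matrix.fromBlocks_map, hx, tailMatrix]
    congr 1; simp
  have hh : (headMatrix x).map (MvPolynomial.eval a) = headMatrix (rectMatrix a) := by
    rw [headMatrix, Matrix.fromBlocks_map, headMatrix, ← hx]
    congr 1 <;> simp [← Matrix.ext_iff]
  rw [map_add, map_mul, MvPolynomial.eval_X, ← hP, ← hQ, orbitPoint, map_add, map_smul,
    smul_eq_mul, hS, ht, Matrix.map_add _ (map_add _), Matrix.map_mul, hS, ht, hh]
  simp

theorem tailMatrix_inl (x : Matrix (Fin 2) (Fin m) ℂ) (i : Fin 2 ⊕ Fin m) (b : Fin 2) :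
    tailMatrix x i (Sum.inl b) = 0 := by
  rcases i with i | i <;> simp [tailMatrix]

theorem coord₀_orbitPoint (S : Matrix (Fin 2 ⊕ Fin m) (Fin 2 ⊕ Fin m) ℂ)
    (x : Matrix (Fin 2) (Fin m) ℂ) (q : ℂ) : coord₀ m (orbitPoint S x q) = 1 := by
  have := evalAt_coord₀ S (C := S * tailMatrix x + headMatrix x) (tailMatrix_inl x) 1 q
  rwa [one_smul] at this

theorem coord₁_orbitPoint (S : Matrix (Fin 2 ⊕ Fin m) (Fin 2 ⊕ Fin m) ℂ)
    (x : Matrix (Fin 2) (Fin m) ℂ) (q : ℂ) (j k : Fin 2 ⊕ Fin m) :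
    coord₁ j k (orbitPoint S x q) = S k j := by
  have := evalAt_coord₁ S (C := S * tailMatrix x + headMatrix x) (tailMatrix_inl x) 1 q j k
  rwa [one_smul, one_mul] at this

theorem quadric_orbitPoint (S : Matrix (Fin 2 ⊕ Fin m) (Fin 2 ⊕ Fin m) ℂ)
    (x : Matrix (Fin 2) (Fin m) ℂ) (q : ℂ) (j k : Fin 2 ⊕ Fin m) :
    evalAt (quadric j k) (orbitPoint S x q) =
      q * (headMatrix x j (Sum.inl 0) * headMatrix x k (Sum.inl 1) -
        headMatrix x j (Sum.inl 1) * headMatrix x k (Sum.inl 0)) := by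
  have h := evalAt_quadric S (C := S * tailMatrix x + headMatrix x) (tailMatrix_inl x) 1 q j k
  have hz : ∀ i b, (S * tailMatrix x) i (Sum.inl b) = 0 := by
    intro i b
    rw [Matrix.mul_apply]
    exact Finset.sum_eq_zero fun l _ => by rw [tailMatrix_inl, mul_zero]
  simp only [Matrix.add_apply, hz, zero_add, one_smul, one_mul] at h
  rw [orbitPoint, h, tailMatrix, Matrix.toBlocks_fromBlocks₂₂, Matrix.det_one, mul_one]

theorem orbitPoint_mem {S : Matrix (Fin 2 ⊕ Fin m) (Fin 2 ⊕ Fin m) ℂ} (hS : Sᵀ = S)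
    (x : Matrix (Fin 2) (Fin m) ℂ) {q : ℂ} (hq : q ≠ 0) (hne : orbitPoint S x q ≠ 0) :
    Projectivization.mk ℂ (orbitPoint S x q) hne ∈ secantOrbit (2 + m) 2 := by
  -- Scaling one head vector by `t⁻¹` and its dual by `t` multiplies the two summands by `t⁻¹` and
  -- `t`, so their ratio `t ^ 2` must equal `q`.
  obtain ⟨t, ht⟩ := IsAlgClosed.exists_pow_nat_eq q (n := 2) two_pos
  have ht0 : t ≠ 0 := by
    rintro rfl
    exact hq (by rw [← ht]; simp)
  let d : Matrix (Fin 2) (Fin 2) ℂ := !![t⁻¹, 0; 0, 1]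
  let d' : Matrix (Fin 2) (Fin 2) ℂ := !![t, 0; 0, 1]
  have hdd : dᵀ * d' = 1 := by
    ext i j
    fin_cases i <;> fin_cases j <;> simp [d, d', Matrix.mul_apply, Fin.sum_univ_two, ht0]
  let K : Matrix (Fin 2 ⊕ Fin m) (Fin 2 ⊕ Fin m) ℂ := fromBlocks d x 0 1
  let Z : Matrix (Fin 2 ⊕ Fin m) (Fin 2 ⊕ Fin m) ℂ := fromBlocks d' 0 (-xᵀ * d') 1
  let K' : Matrix (Fin 2 ⊕ Fin m) (Fin 2 ⊕ Fin m) ℂ := fromBlocks d' 0 0 1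
  have hKZ : Kᵀ * Z = 1 := by
    simp only [K, Z, Matrix.fromBlocks_transpose, Matrix.fromBlocks_multiply, hdd]
    simp
  have hmem : blockMatrix K 0 (S * K) Z ∈ symplecticGroup (Fin (2 + m)) ℂ := by
    refine blockMatrix_mem_iff.2 ⟨?_, ?_, ?_⟩
    · rw [Matrix.transpose_mul, hS, Matrix.mul_assoc]
    · simp
    · rw [hKZ, Matrix.mul_zero, sub_zero]
  have hK : K.det = t⁻¹ := by
    simp [K, d, Matrix.det_fin_two]
  have hK' : K'.det = t := by
    simp [K', d', Matrix.det_fin_two]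
  have e1 : K * tailProj m = tailMatrix x * K' := by
    simp [K, K', tailProj, tailMatrix, Matrix.fromBlocks_multiply]
  have e2 : Z * headProj m = headMatrix x * K' := by
    simp [Z, K', headProj, headMatrix, Matrix.fromBlocks_multiply]
  refine (mk_mem_secantOrbit hne).2 ⟨_, hmem, t, ht0, ?_⟩
  rw [map_blockMatrix_secantVector, Matrix.zero_mul, add_zero, Matrix.mul_assoc S, e1, e2,
    ← Matrix.mul_assoc, ← Matrix.add_mul, wedge_mul, hK']
  have := wedge_mul 1 S K
  rw [Matrix.one_mul] at this
  rw [this, hK, smul_add, smul_smul, smul_smul, mul_inv_cancel₀ ht0, one_smul, ← pow_two, ht,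
    orbitPoint]

/-- After the graph form, column operations remain. The quadric makes the lower right block of `A`
invertible, so the tail columns reduce to `tailMatrix x`; duality with `A` then forces the two
vertical head vectors into the span of the columns of `headMatrix x`. -/
theorem exists_eq_smul_orbitPoint_of_det_ne_zero
    {A B C D : Matrix (Fin 2 ⊕ Fin m) (Fin 2 ⊕ Fin m) ℂ}
    (hg : blockMatrix A B C D ∈ symplecticGroup (Fin (2 + m)) ℂ) (hA : A.det ≠ 0)
    {v : ⋀[ℂ]^(2 + m) (SympSpace (2 + m))}
    (hv : v = wedge A C +
      wedge (A * tailProj m + B * headProj m) (C * tailProj m + D * headProj m))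
    (h₀ : coord₀ m v ≠ 0) (h₂ : evalAt (quadric (Sum.inl 0) (Sum.inl 1)) v ≠ 0) :
    ∃ S x q, ∃ c : ℂ, Sᵀ = S ∧ v = c • orbitPoint S x q := by
  subst hv
  obtain ⟨S, Y, c, hS, hAY, hc, hw⟩ := exists_graph_form hg hA h₀
  rw [hw] at h₂ ⊢
  have hz : ∀ i b, (A * tailProj m) i (Sum.inl b) = 0 := by
    intro i b
    simp [tailProj, Matrix.mul_apply]
  rw [evalAt_quadric S hz] at h₂
  have hA22 : (A * tailProj m).toBlocks₂₂ = A.toBlocks₂₂ := by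
    ext i j
    simp [tailProj, Matrix.mul_apply, Matrix.toBlocks₂₂, Matrix.one_apply]
  have hH : A.toBlocks₂₂.det ≠ 0 := by
    rw [← hA22]
    exact right_ne_zero_of_mul (right_ne_zero_of_mul h₂)
  obtain ⟨x, hx⟩ : ∃ x : Matrix (Fin 2) (Fin m) ℂ, x * A.toBlocks₂₂ = A.toBlocks₁₂ :=
    ⟨A.toBlocks₁₂ * A.toBlocks₂₂⁻¹, by
      rw [Matrix.mul_assoc, Matrix.nonsing_inv_mul _ (Ne.isUnit hH), Matrix.mul_one]⟩
  let P := A.toBlocks₁₁ - x * A.toBlocks₂₁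
  have hAX : A = fromBlocks 1 x 0 1 * fromBlocks P 0 A.toBlocks₂₁ A.toBlocks₂₂ := by
    conv_lhs => rw [← Matrix.fromBlocks_toBlocks A]
    simp [Matrix.fromBlocks_multiply, P, hx]
  have hP : P.det ≠ 0 := by
    intro h
    apply hA
    rw [hAX, Matrix.det_mul, Matrix.det_fromBlocks_zero₁₂, h]
    simp
  let K : Matrix (Fin 2 ⊕ Fin m) (Fin 2 ⊕ Fin m) ℂ := fromBlocks (Pᵀ)⁻¹ 0 0 A.toBlocks₂₂
  have e1 : A * tailProj m = tailMatrix x * K := by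
    conv_lhs => rw [← Matrix.fromBlocks_toBlocks A]
    simp [tailProj, tailMatrix, K, Matrix.fromBlocks_multiply, hx]
  have hYA : Yᵀ * Aᵀ = 1 := by rw [← Matrix.transpose_mul, hAY, Matrix.transpose_one]
  have e2 : Yᵀ * headProj m = headMatrix x * K := by
    have hPP : Pᵀ * (Pᵀ)⁻¹ = 1 := Matrix.mul_nonsing_inv _ (by
      rw [Matrix.det_transpose]; exact Ne.isUnit hP)
    have : Aᵀ * (headMatrix x * K) = headProj m := by
      rw [← Matrix.mul_assoc]
      have : Aᵀ * headMatrix x = fromBlocks Pᵀ 0 0 0 := by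
        rw [hAX]
        simp [headMatrix, Matrix.fromBlocks_transpose, Matrix.fromBlocks_multiply]
      rw [this]
      simp [K, Matrix.fromBlocks_multiply, hPP, headProj]
    rw [← this, ← Matrix.mul_assoc, hYA, Matrix.one_mul]
  refine ⟨S, x, (c * A.det)⁻¹ * (c⁻¹ * K.det), c * A.det, hS, ?_⟩
  rw [e1, e2, ← Matrix.mul_assoc, ← Matrix.add_mul, wedge_mul, orbitPoint, smul_add, smul_smul,
    smul_smul, mul_inv_cancel_left₀ (mul_ne_zero hc hA)]

theorem exists_eq_smul_orbitPoint {x : ℙ ℂ (⋀[ℂ]^(2 + m) (SympSpace (2 + m)))}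
    (hx : x ∈ secantOrbit (2 + m) 2) (h₀ : coord₀ m x.rep ≠ 0)
    (h₂ : evalAt (quadric (Sum.inl 0) (Sum.inl 1)) x.rep ≠ 0) :
    ∃ S y q, ∃ c : ℂ, Sᵀ = S ∧ x.rep = c • orbitPoint S y q := by
  rw [← Projectivization.mk_rep x] at hx
  obtain ⟨g, hg, t, ht, hxt⟩ := (mk_mem_secantOrbit x.rep_nonzero).1 hx
  rw [hxt] at h₀ h₂ ⊢
  rw [map_smul, smul_eq_mul] at h₀
  rw [evalAt_smul (quadric_isHomogeneous _ _)] at h₂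
  replace h₀ := right_ne_zero_of_mul h₀
  replace h₂ := right_ne_zero_of_mul h₂
  obtain ⟨A, B, C, D, rfl⟩ := exists_eq_blockMatrix g
  rw [map_blockMatrix_secantVector] at h₀ h₂ ⊢
  suffices ∃ S y q, ∃ c : ℂ, Sᵀ = S ∧ wedge A C +
      wedge (A * tailProj m + B * headProj m) (C * tailProj m + D * headProj m) =
        c • orbitPoint S y q by
    obtain ⟨S, y, q, c, hS, h⟩ := this
    exact ⟨S, y, q, t * c, hS, by rw [h, smul_smul]⟩
  by_cases hA : A.det = 0
  -- If the first subspace is not a graph, `h₀` makes the second one a graph. Right multiplication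
  -- by this Weyl element, `e_b ↦ e_{-b}` and `e_{-b} ↦ -e_b` for `b = 1, 2`, exchanges them; the
  -- two signs cancel in the determinant.
  · have hmem : blockMatrix (tailProj m) (-headProj m) (headProj m) (tailProj m) ∈
        symplecticGroup (Fin (2 + m)) ℂ := by
      rw [blockMatrix_mem_iff]
      simp [tailProj, headProj, Matrix.fromBlocks_transpose, Matrix.fromBlocks_multiply,
        Matrix.fromBlocks_neg, sub_eq_add_neg, Matrix.fromBlocks_add]
    have hg' := mul_mem hg hmem
    rw [blockMatrix_mul] at hg'
    have hA' : (A * tailProj m + B * headProj m).det ≠ 0 := by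
      rwa [map_add, coord₀_wedge, coord₀_wedge, hA, zero_add] at h₀
    have htt : tailProj m * tailProj m = tailProj m := by
      simp [tailProj, Matrix.fromBlocks_multiply]
    have hth : tailProj m * headProj m = 0 := by
      simp [tailProj, headProj, Matrix.fromBlocks_multiply]
    have hht : headProj m * tailProj m = 0 := by
      simp [tailProj, headProj, Matrix.fromBlocks_multiply]
    have hhh : headProj m * headProj m = headProj m := by
      simp [headProj, Matrix.fromBlocks_multiply]
    have key : ∀ M L : Matrix (Fin 2 ⊕ Fin m) (Fin 2 ⊕ Fin m) ℂ,
        (M * tailProj m + L * headProj m) * tailProj m +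
          (M * -headProj m + L * tailProj m) * headProj m = M * (tailProj m - headProj m) := by
      intro M L
      simp only [Matrix.add_mul, Matrix.mul_assoc, htt, hth, hht, hhh, Matrix.neg_mul,
        Matrix.mul_zero, Matrix.mul_neg, Matrix.mul_sub]
      abel
    have hdet : (tailProj m - headProj m).det = 1 := by
      have : tailProj m - headProj m = fromBlocks (-1) 0 0 1 := by
        simp [tailProj, headProj, sub_eq_add_neg, Matrix.fromBlocks_neg, Matrix.fromBlocks_add]
      rw [this, Matrix.det_fromBlocks_zero₂₁, Matrix.det_neg]
      simp
    refine exists_eq_smul_orbitPoint_of_det_ne_zero hg' hA' ?_ h₀ h₂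
    rw [key, key, wedge_mul, hdet, one_smul]
    exact add_comm _ _
  · exact exists_eq_smul_orbitPoint_of_det_ne_zero hg hA rfl h₀ h₂

/-- The top block of `headMatrix x` is the identity, so replacing one of its rows by row `i` of
`-xᵀ` isolates a single entry of `x`. -/
theorem headMatrix_minor (x : Matrix (Fin 2) (Fin m) ℂ) (b : Fin 2) (i : Fin m) :
    headMatrix x (Function.update Sum.inl b (Sum.inr i) 0) (Sum.inl 0) *
        headMatrix x (Function.update Sum.inl b (Sum.inr i) 1) (Sum.inl 1) -
      headMatrix x (Function.update Sum.inl b (Sum.inr i) 0) (Sum.inl 1) *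
        headMatrix x (Function.update Sum.inl b (Sum.inr i) 1) (Sum.inl 0) = -x b i := by
  fin_cases b <;> simp [headMatrix, Function.update]

/-- The denominator of the chart of the orbit. -/
noncomputable def orbitDen (m : ℕ) :
    MvPolynomial (Module.Dual ℂ (⋀[ℂ]^(2 + m) (SympSpace (2 + m)))) ℂ :=
  MvPolynomial.X (coord₀ m) ^ 2 * quadric (Sum.inl 0) (Sum.inl 1)

theorem evalAt_orbitDen_orbitPoint (S : Matrix (Fin 2 ⊕ Fin m) (Fin 2 ⊕ Fin m) ℂ)
    (x : Matrix (Fin 2) (Fin m) ℂ) (q : ℂ) : evalAt (orbitDen m) (orbitPoint S x q) = q := by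
  simp [orbitDen, coord₀_orbitPoint, quadric_orbitPoint, headMatrix]

/-- The chart of the orbit around its base point. -/
noncomputable def orbitChart (m : ℕ) : ProjChart (secantOrbit (2 + m) 2) (OrbitIndex m) where
  toFun a := orbitPoint (symmMatrix a) (rectMatrix a) (a (Sum.inr (Sum.inr ())))
  poly := exists_polynomial_orbitPoint
  deg := 4
  den := orbitDen m
  num := Sum.elim
    -- At an `orbitPoint` the denominator is `q`, and these values are `q` times the entries of `S`
    -- and `x`, and `q ^ 2`. The powers of `coord₀`, which is `1` there, equalize the degrees.
    -- Either order of an unordered pair works because `S` is symmetric.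
    (fun s => MvPolynomial.X (coord₁ (Quot.out s).1 (Quot.out s).2) *
      MvPolynomial.X (coord₀ m) * quadric (Sum.inl 0) (Sum.inl 1))
    (Sum.elim
      (fun p => -(MvPolynomial.X (coord₀ m) ^ 2 *
        quadric (Function.update Sum.inl p.1 (Sum.inr p.2) 0)
          (Function.update Sum.inl p.1 (Sum.inr p.2) 1)))
      (fun _ => quadric (Sum.inl 0) (Sum.inl 1) * quadric (Sum.inl 0) (Sum.inl 1)))
  den_hom := (MvPolynomial.isHomogeneous_X_pow _ 2).mul (quadric_isHomogeneous _ _)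
  num_hom := by
    rintro (s | p | u)
    · exact ((MvPolynomial.isHomogeneous_X _ _).mul (MvPolynomial.isHomogeneous_X _ _)).mul
        (quadric_isHomogeneous _ _)
    · exact ((MvPolynomial.isHomogeneous_X_pow _ 2).mul (quadric_isHomogeneous _ _)).neg
    · exact (quadric_isHomogeneous _ _).mul (quadric_isHomogeneous _ _)
  eval_num a i := by
    have hq : ∀ S x q, evalAt (quadric (Sum.inl 0) (Sum.inl 1)) (orbitPoint (m := m) S x q) = q := by
      intro S x q
      simp [quadric_orbitPoint, headMatrix]
    rw [evalAt_orbitDen_orbitPoint]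
    rcases i with s | p | u
    · simp only [Sum.elim_inl, evalAt_mul, evalAt_X, coord₁_orbitPoint, coord₀_orbitPoint, hq,
        mul_one]
      congr 1
      rw [symmMatrix, Matrix.of_apply, Sym2.eq_swap]
      congr 2
      exact Quot.out_eq s
    · simp only [Sum.elim_inl, Sum.elim_inr, evalAt_neg, evalAt_mul, evalAt_pow, evalAt_X,
        coord₀_orbitPoint, quadric_orbitPoint, headMatrix_minor, rectMatrix, Matrix.of_apply]
      ring
    · simp only [Sum.elim_inr, evalAt_mul, hq]
  ne_zero a h := by
    have := coord₀_orbitPoint (symmMatrix a) (rectMatrix a) (a (Sum.inr (Sum.inr ())))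
    rw [h, map_zero] at this
    exact zero_ne_one this
  mem a h := by
    rw [evalAt_orbitDen_orbitPoint] at h
    refine orbitPoint_mem ?_ _ h _
    ext i j
    simp [symmMatrix, Sym2.eq_swap]
  surj x hx h := by
    rw [orbitDen, evalAt_mul, evalAt_pow, evalAt_X] at h
    obtain ⟨S, y, q, c, hS, hxc⟩ := exists_eq_smul_orbitPoint hx
      (ne_zero_pow two_ne_zero (left_ne_zero_of_mul h)) (right_ne_zero_of_mul h)
    refine ⟨Sum.elim (Sym2.lift ⟨fun i j => S i j, fun i j => congrFun (congrFun hS j) i⟩)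
      (Sum.elim (fun p => y p.1 p.2) fun _ => q), c, ?_⟩
    rw [hxc]
    congr 2

theorem evalAt_orbitDen_secantVector :
    evalAt (orbitDen m) (secantVector (2 + m) 2) ≠ 0 := by
  have h : secantVector (2 + m) 2 = orbitPoint 0 0 1 := by
    rw [secantVector_eq_wedge, orbitPoint, one_smul, Matrix.zero_mul, zero_add]
    simp [tailProj, tailMatrix, headProj, headMatrix]
  rw [h, evalAt_orbitDen_orbitPoint]
  exact one_ne_zero

/-- By homogeneity, the chart around the base point is carried to `x` by a group element. -/
theorem exists_chart_at {x : ℙ ℂ (⋀[ℂ]^(2 + m) (SympSpace (2 + m)))}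
    (hx : x ∈ secantOrbit (2 + m) 2) :
    ∃ c : ProjChart (secantOrbit (2 + m) 2) (OrbitIndex m), evalAt c.den x.rep ≠ 0 := by
  rw [← Projectivization.mk_rep x] at hx
  obtain ⟨g, hg, t, ht, hxt⟩ := (mk_mem_secantOrbit x.rep_nonzero).1 hx
  have hdet := SymplecticGroup.symplectic_det hg
  have hg' : g⁻¹ ∈ symplecticGroup (Fin (2 + m)) ℂ := by
    rw [← SymplecticGroup.coe_inv' ⟨g, hg⟩]
    exact Subtype.property _
  refine ⟨(orbitChart m).transport (exteriorPower.map (2 + m) (mulVecLin g))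
    (exteriorPower.map (2 + m) (mulVecLin g⁻¹))
    (fun v => by rw [← map_mulVecLin_mul, Matrix.mul_nonsing_inv _ hdet, map_mulVecLin_one])
    (fun v => by rw [← map_mulVecLin_mul, Matrix.nonsing_inv_mul _ hdet, map_mulVecLin_one])
    (map_mem_secantOrbit hg) (map_mem_secantOrbit hg'), ?_⟩
  rw [ProjChart.evalAt_transport_den, hxt, map_smul, ← map_mulVecLin_mul,
    Matrix.nonsing_inv_mul _ hdet, map_mulVecLin_one, evalAt_smul (orbitChart m).den_hom]
  exact mul_ne_zero (pow_ne_zero _ ht) evalAt_orbitDen_secantVector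

theorem zariskiDim_secantOrbit (m : ℕ) : zariskiDim (secantOrbit (2 + m) 2) =
    (((2 + m) * (2 + m + 1) / 2 + 2 * (2 + m) - 3 : ℕ) : WithBot ℕ∞) := by
  rw [← card_orbitIndex]
  refine le_antisymm (ProjChart.zariskiDim_le fun x hx => exists_chart_at hx) ?_
  refine (orbitChart m).le_zariskiDim (a₀ := Sum.elim 0 (Sum.elim 0 1)) ?_
  change evalAt (orbitDen m) (orbitPoint _ _ _) ≠ 0
  rw [evalAt_orbitDen_orbitPoint]
  exact one_ne_zero

end OrbitDimension

theorem mainTheorem11 (N : ℕ) (hN : 4 ≤ N) :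
    secantOrbit N 2 ⊆ secantVariety (lagrangianGrassmannian N) ∧
      zariskiDim (secantOrbit N 2) = ((N * (N + 1) / 2 + 2 * N - 3 : ℕ) : WithBot ℕ∞) := by
  obtain ⟨m, rfl⟩ := Nat.exists_eq_add_of_le (le_trans (by norm_num : 2 ≤ 4) hN)
  exact ⟨secantOrbit_subset_secantVariety m, zariskiDim_secantOrbit m⟩
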